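/- A weight is a locally integrable function $w$ on $\mathbb{R}$ which is positive almost everywhere. For a bounded nondegenerate interval $J\subset\mathbb{R}$ put $m_J f=\frac1{|J|}\int_J f\,dx$, and define $$[w]_{A_\infty}=\sup_{J}\; m_J w\; e^{-m_J(\log w)},\qquad [w]_{RH_1}=\sup_{J}\; m_J\!\left(\frac{w}{m_Jw}\log\frac{w}{m_Jw}\right),$$ where the suprema are over all such intervals $J$, take values in $[0,\infty]$, and $m_J(\log w)=-\infty$ (respectively $m_J(\frac{w}{m_Jw}\log\frac{w}{m_Jw})=+\infty$) if the function in question is not integrable on $J$. A weight $w$ belongs to $A_\infty$ if $[w]_{A_\infty}<\infty$, and to $RH_1$ if $[w]_{RH_1}<\infty$. **Theorem.** A weight $w$ belongs to $A_\infty$ if and only if it belongs to $RH_1$. Moreover, every weight $w$ satisfies $$[w]_{RH_1}\le e\,[w]_{A_\infty},$$ and the constant $e$ is best possible: for every real $C<e$ there is a weight $w\in A_\infty$ with $[w]_{RH_1}>C\,[w]_{A_\infty}$. -/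

import Mathlib

open MeasureTheory Set
open scoped ENNReal

noncomputable section

/-- A weight on the real line: locally integrable and positive almost everywhere. -/
def IsWeight (w : ℝ → ℝ) : Prop :=
  LocallyIntegrable w volume ∧ ∀ᵐ x ∂(volume : Measure ℝ), 0 < w x

/-- The average of `f` over the interval with endpoints `a < b`. -/
def intervalMean (f : ℝ → ℝ) (a b : ℝ) : ℝ :=
  ⨍ x in Icc a b, f x

open Classical in
/-- The quantity `m_J(w) * exp (- m_J(log w))` for `J = [a, b]`, as an extended nonnegative real.
For a weight the positive part of `log w` is integrable on `J`, so if `log w` is not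
integrable on `J` then `m_J(log w) = -∞` and the quantity is `+∞`. -/
def aInftyOn (w : ℝ → ℝ) (a b : ℝ) : ℝ≥0∞ :=
  if IntegrableOn (fun x => Real.log (w x)) (Icc a b) volume then
    ENNReal.ofReal
      (intervalMean w a b * Real.exp (-intervalMean (fun x => Real.log (w x)) a b))
  else ⊤

/-- The constant `[w]_{A_∞}`: the supremum over all bounded nondegenerate intervals. -/
def aInftyConst (w : ℝ → ℝ) : ℝ≥0∞ :=
  ⨆ (a : ℝ) (b : ℝ) (_ : a < b), aInftyOn w a b

/-- The function `(w / m_J w) log (w / m_J w)` for `J = [a, b]`. -/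
def rhOneIntegrand (w : ℝ → ℝ) (a b : ℝ) (x : ℝ) : ℝ :=
  w x / intervalMean w a b * Real.log (w x / intervalMean w a b)

open Classical in
/-- The quantity `m_J((w / m_J w) log (w / m_J w))` for `J = [a, b]`, as an extended nonnegative
real. For a weight the integrand is bounded below by `-1/e` almost everywhere, so if it is not
integrable on `J` its mean is `+∞`; if it is integrable its mean is nonnegative by Jensen's
inequality, so `ENNReal.ofReal` does not change it. -/
def rhOneOn (w : ℝ → ℝ) (a b : ℝ) : ℝ≥0∞ :=
  if IntegrableOn (rhOneIntegrand w a b) (Icc a b) volume then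
    ENNReal.ofReal (intervalMean (rhOneIntegrand w a b) a b)
  else ⊤

/-- The constant `[w]_{RH_1}`: the supremum over all bounded nondegenerate intervals. -/
def rhOneConst (w : ℝ → ℝ) : ℝ≥0∞ :=
  ⨆ (a : ℝ) (b : ℝ) (_ : a < b), rhOneOn w a b

/-- Membership of a weight in the Muckenhoupt class `A_∞`. -/
def MemAInfty (w : ℝ → ℝ) : Prop :=
  IsWeight w ∧ aInftyConst w < ⊤

/-- Membership of a weight in the class `RH_1`. -/
def MemRHOne (w : ℝ → ℝ) : Prop :=
  IsWeight w ∧ rhOneConst w < ⊤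

end

/-! Both inequalities come from one estimate. Let u, v > 0 have equal integrals over (a, b), and for
l > 1 let Ω_l be a rising-sun set of φ_l(x) = ∫_a^x (u − l v): each of its components satisfies ∫ u
= l ∫ v exactly, and u ≤ l v a.e. off Ω_l. By the layer-cake formula ∫ u log⁺(u/v) ≤ ∫_1^∞ u(Ω_l)
dl/l = ∫_1^∞ v(Ω_l) dl. If reverse Jensen holds on the components, then v(Ω_l) ≤ ∫_{Ω_l} v (1 +
log(Qu/v) − log l). After Fubini the integral in l is at most K − 1 − log K with K = eQu/v, and
integrating against v gives at most eQ ∫ v (`integral_mul_log_div_le_of_reverse_jensen`). The choice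
u = w/m_J w, v = 1 is the sharp bound; the choice u = m_J w, v = w gives the converse inclusion.

For sharpness, the distribution of s^(γ−1) on (0, 1) has the ratio (γ log γ + 1 − γ) e^(1−γ), which
tends to e as γ → 0. A weight with nearly this distribution is built by repeatedly squeezing many
periods of the previous weight into most of a period and filling the rest with a constant
(`splice`). Because the scales are widely separated, the pair (mean of w, mean of log w) of any
interval stays near a triangle inside the region allowed by the A_∞ condition
(`exists_isCascade_step`, `triangle_le_exp`). -/

/-! ### Entropy bound from superlevel sets, on an abstract measure space. -/

/-- Integrating the positive part of `log K - log l` over `1 < l`. -/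
theorem setIntegral_log_sub_log_le {K T : ℝ} (hK : 0 < K) {s : Set ℝ} (hs : MeasurableSet s) :
    ∫ l in Ioc 1 T, s.indicator (fun l => Real.log K - Real.log l) l ≤ K - 1 - Real.log K := by
  have hlog : ∀ A B : ℝ, 0 < A → IntegrableOn (fun l => Real.log K - Real.log l) (Ioc A B) := by
    intro A B hA
    refine (ContinuousOn.integrableOn_Icc ?_).mono_set Ioc_subset_Icc_self
    refine continuousOn_const.sub (Real.continuousOn_log.mono ?_)
    intro x hx
    exact (lt_of_lt_of_le hA hx.1).ne'
  have hKl := Real.log_le_sub_one_of_pos hK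
  rcases le_total K 1 with h1 | h1
  · refine le_trans (setIntegral_nonpos measurableSet_Ioc fun l hl => ?_) (by linarith)
    refine indicator_apply_le' (fun _ => ?_) (fun _ => le_rfl)
    exact sub_nonpos.2 (Real.log_le_log hK (h1.trans hl.1.le))
  · have hmax : ∫ l in Ioc 1 K, (Real.log K - Real.log l) = K - 1 - Real.log K := by
      rw [← intervalIntegral.integral_of_le h1, intervalIntegral.integral_sub
        intervalIntegrable_const (intervalIntegral.intervalIntegrable_log'), integral_log]
      simp
      ring
    rw [← hmax]
    calc ∫ l in Ioc 1 T, s.indicator (fun l => Real.log K - Real.log l) l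
        ≤ ∫ l in Ioc 1 T, (Ioc 1 K).indicator (fun l => Real.log K - Real.log l) l := by
          refine setIntegral_mono_on ((hlog 1 T one_pos).indicator hs)
            ((hlog 1 T one_pos).indicator measurableSet_Ioc) measurableSet_Ioc fun l hl => ?_
          have hl0 : 0 < l := one_pos.trans hl.1
          by_cases hlK : l ≤ K
          · rw [indicator_of_mem (show l ∈ Ioc 1 K from ⟨hl.1, hlK⟩)]
            exact indicator_le_self' (fun _ _ => sub_nonneg.2 (Real.log_le_log hl0 hlK)) l
          · rw [indicator_of_notMem (show l ∉ Ioc 1 K from fun h => hlK h.2)]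
            refine indicator_apply_le' (fun _ => ?_) (fun _ => le_rfl)
            exact sub_nonpos.2 (Real.log_le_log hK (not_le.1 hlK).le)
      _ = ∫ l in Ioc 1 T ∩ Ioc 1 K, (Real.log K - Real.log l) :=
          setIntegral_indicator measurableSet_Ioc
      _ ≤ _ := by
          refine setIntegral_mono_set (hlog 1 K one_pos) ?_ (inter_subset_right.eventuallyLE)
          refine (ae_restrict_iff' measurableSet_Ioc).2 (ae_of_all _ fun l hl => ?_)
          exact sub_nonneg.2 (Real.log_le_log (one_pos.trans hl.1) hl.2)

theorem ofReal_max_zero (r : ℝ) : ENNReal.ofReal (max r 0) = ENNReal.ofReal r := by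
  rw [ENNReal.ofReal_max, ENNReal.ofReal_zero, max_eq_left zero_le]

section Abstract

variable {X : Type*} [MeasurableSpace X] {κ : Measure X} [SFinite κ] {u v : X → ℝ}

/-- If every superlevel set `{x | (x, l) ∈ S}` satisfies a reverse Jensen inequality with constant
`Q`, then the `v`-measures of these sets are integrable in `l`, with an explicit bound. -/
theorem setIntegral_measure_superlevel_le {Q : ℝ} (hQ : 0 < Q)
    (hu : ∀ᵐ x ∂κ, 0 < u x) (hv : ∀ᵐ x ∂κ, 0 < v x) (hui : Integrable u κ) (hvi : Integrable v κ)
    (hlogi : Integrable (fun x => v x * Real.log (u x / v x)) κ)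
    (huv : ∫ x, u x ∂κ = ∫ x, v x ∂κ)
    {S : Set (X × ℝ)} (hS : MeasurableSet S)
    (h0 : -Real.log Q * ∫ x, v x ∂κ ≤ ∫ x, v x * Real.log (u x / v x) ∂κ)
    (hl : ∀ l : ℝ, 1 < l → (Real.log l - Real.log Q) * ∫ x in {x | (x, l) ∈ S}, v x ∂κ ≤
      ∫ x in {x | (x, l) ∈ S}, v x * Real.log (u x / v x) ∂κ) (T : ℝ) :
    ∫ l in Ioc 1 T, ∫ x in {x | (x, l) ∈ S}, v x ∂κ ≤
      (Real.exp 1 * Q - 2) * ∫ x, v x ∂κ := by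
  have hSl : ∀ l : ℝ, MeasurableSet {x | (x, l) ∈ S} := fun l => hS.preimage (by fun_prop)
  have hSx : ∀ x : X, MeasurableSet {l | (x, l) ∈ S} := fun x => hS.preimage (by fun_prop)
  -- On each slice v (log(u/v) + log Q − log l) has nonnegative integral by `hl`, so adding v makes
  -- the slice integral dominate ∫ v. The added 1 turns the bracket into log K − log l with K =
  -- eQu/v, which is the source of the constant e. The factor `* 1` only puts the term in product
  -- form.
  let G : X × ℝ → ℝ := S.indicator
    (fun p => v p.1 * Real.log (u p.1 / v p.1) * 1 + v p.1 * (Real.log Q + 1 - Real.log p.2))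
  have hlog : IntegrableOn (fun l => Real.log Q + 1 - Real.log l) (Ioc 1 T) := by
    refine (ContinuousOn.integrableOn_Icc ?_).mono_set Ioc_subset_Icc_self
    refine continuousOn_const.sub (Real.continuousOn_log.mono ?_)
    intro x hx
    exact (lt_of_lt_of_le one_pos hx.1).ne'
  have hG : Integrable G (κ.prod (volume.restrict (Ioc 1 T))) := by
    refine Integrable.indicator ?_ hS
    exact (hlogi.mul_prod (integrable_const (1 : ℝ))).add (hvi.mul_prod hlog)
  have hv' : Integrable (S.indicator fun p : X × ℝ => v p.1 * 1)
      (κ.prod (volume.restrict (Ioc 1 T))) :=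
    (hvi.mul_prod (integrable_const (1 : ℝ))).indicator hS
  have step1 : ∫ l in Ioc 1 T, ∫ x in {x | (x, l) ∈ S}, v x ∂κ ≤
      ∫ l in Ioc 1 T, ∫ x, G (x, l) ∂κ := by
    refine setIntegral_mono_on ?_ hG.integral_prod_right measurableSet_Ioc fun l hl1 => ?_
    · have := hv'.integral_prod_right
      refine this.congr (ae_of_all _ fun l => ?_)
      simp only [mul_one]
      rw [← integral_indicator (hSl l)]
      rfl
    · have e : ∫ x, G (x, l) ∂κ = ∫ x in {x | (x, l) ∈ S},
          (v x * Real.log (u x / v x) + v x * (Real.log Q + 1 - Real.log l)) ∂κ := by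
        rw [← integral_indicator (hSl l)]
        refine integral_congr_ae (ae_of_all _ fun x => ?_)
        simp only [G, indicator, mul_one]
        rfl
      rw [e, integral_add hlogi.integrableOn (hvi.integrableOn.mul_const _), integral_mul_const]
      have := hl l hl1.1
      nlinarith
  refine step1.trans ?_
  rw [integral_integral_swap (f := fun l x => G (x, l)) hG.swap]
  have step2 : ∫ x, (∫ l in Ioc 1 T, G (x, l)) ∂κ ≤ ∫ x, (Real.exp 1 * Q * u x - v x -
      (v x * Real.log (u x / v x) + v x * (Real.log Q + 1))) ∂κ := by
    refine integral_mono_ae hG.integral_prod_left ?_ ?_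
    · exact ((hui.const_mul _).sub hvi).sub (hlogi.add (hvi.mul_const _))
    · filter_upwards [hu, hv] with x hux hvx
      have hK : 0 < Real.exp 1 * Q * (u x / v x) := by positivity
      have hlK : Real.log (Real.exp 1 * Q * (u x / v x)) =
          1 + Real.log Q + Real.log (u x / v x) := by
        rw [Real.log_mul (by positivity) (by positivity), Real.log_mul (by positivity)
          (by positivity), Real.log_exp]
      have key := setIntegral_log_sub_log_le (T := T) hK (hSx x)
      have e : ∀ l, G (x, l) = v x * ({l | (x, l) ∈ S}.indicator
          (fun l => Real.log (Real.exp 1 * Q * (u x / v x)) - Real.log l) l) := by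
        intro l
        simp only [G, indicator, mem_ofPred_eq]
        split_ifs
        · rw [hlK]; ring
        · simp
      simp only [e]
      rw [integral_const_mul]
      refine (mul_le_mul_of_nonneg_left key hvx.le).trans (le_of_eq ?_)
      rw [hlK]
      field_simp
      ring
  refine step2.trans ?_
  have e1 : ∫ x, (Real.exp 1 * Q * u x - v x -
      (v x * Real.log (u x / v x) + v x * (Real.log Q + 1))) ∂κ =
      ∫ x, (Real.exp 1 * Q * u x - v x) ∂κ -
        ∫ x, (v x * Real.log (u x / v x) + v x * (Real.log Q + 1)) ∂κ :=
    integral_sub ((hui.const_mul _).sub hvi) (hlogi.add (hvi.mul_const _))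
  -- The remaining terms −log Q ∫ v − ∫ v log(u/v) are nonpositive by `h0`, the case l = 1 on the
  -- whole space.
  rw [e1, integral_sub (hui.const_mul _) hvi, integral_add hlogi (hvi.mul_const _),
    integral_const_mul, integral_mul_const, huv]
  linarith

theorem lintegral_Ioi_inv_eq {z : ℝ} (hz : 0 < z) :
    ∫⁻ l in Ioi (1 : ℝ), (Iio z).indicator (fun l => ENNReal.ofReal l⁻¹) l =
      ENNReal.ofReal (Real.log z) := by
  rw [lintegral_indicator measurableSet_Iio, Measure.restrict_restrict measurableSet_Iio,
    inter_comm, Ioi_inter_Iio]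
  rcases le_total z 1 with h | h
  · rw [Ioo_eq_empty (not_lt.2 h), Measure.restrict_empty, lintegral_zero_measure,
      ENNReal.ofReal_of_nonpos (Real.log_nonpos hz.le h)]
  · rw [← ofReal_integral_eq_lintegral_ofReal, ← integral_Ioc_eq_integral_Ioo,
      ← intervalIntegral.integral_of_le h, integral_inv_of_pos one_pos hz, div_one]
    · refine (ContinuousOn.integrableOn_Icc ?_).mono_set Ioo_subset_Icc_self
      exact continuousOn_inv₀.mono fun x hx => (one_pos.trans_le hx.1).ne'
    · refine (ae_restrict_iff' measurableSet_Ioo).2 (ae_of_all _ fun l hl => ?_)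
      exact inv_nonneg.2 (one_pos.trans hl.1).le

/-- Layer cake: u log⁺(u/v) is the integral of u/l over those l > 1 with l v < u. By `hout` such
points lie in the slice of S, and `hmean` trades u for l v there, cancelling the 1/l. -/
theorem lintegral_mul_log_div_le
    (hu : ∀ᵐ x ∂κ, 0 < u x) (hv : ∀ᵐ x ∂κ, 0 < v x) (hui : Integrable u κ) (hvi : Integrable v κ)
    {S : Set (X × ℝ)} (hS : MeasurableSet S)
    (hout : ∀ l : ℝ, 1 < l → ∀ᵐ x ∂κ, (x, l) ∉ S → u x ≤ l * v x)
    (hmean : ∀ l : ℝ, 1 < l → ∫ x in {x | (x, l) ∈ S}, u x ∂κ ≤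
      l * ∫ x in {x | (x, l) ∈ S}, v x ∂κ) :
    ∫⁻ x, ENNReal.ofReal (u x * Real.log (u x / v x)) ∂κ ≤
      ∫⁻ l in Ioi 1, ENNReal.ofReal (∫ x in {x | (x, l) ∈ S}, v x ∂κ) := by
  have hSl : ∀ l : ℝ, MeasurableSet {x | (x, l) ∈ S} := fun l => hS.preimage (by fun_prop)
  let F : X × ℝ → ℝ≥0∞ := {p : X × ℝ | p.2 * v p.1 < u p.1}.indicator
    (fun p => ENNReal.ofReal (u p.1 * p.2⁻¹))
  have hF : AEMeasurable F (κ.prod (volume.restrict (Ioi (1 : ℝ)))) := by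
    have h1 : AEMeasurable (fun p : X × ℝ => u p.1) (κ.prod (volume.restrict (Ioi (1 : ℝ)))) :=
      hui.1.aemeasurable.comp_fst
    have h2 : AEMeasurable (fun p : X × ℝ => v p.1) (κ.prod (volume.restrict (Ioi (1 : ℝ)))) :=
      hvi.1.aemeasurable.comp_fst
    have h3 : AEMeasurable (fun p : X × ℝ => p.2) (κ.prod (volume.restrict (Ioi (1 : ℝ)))) :=
      measurable_snd.aemeasurable
    exact (h1.mul h3.inv).ennreal_ofReal.indicator₀ (nullMeasurableSet_lt (h3.mul h2) h1)
  calc ∫⁻ x, ENNReal.ofReal (u x * Real.log (u x / v x)) ∂κ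
      = ∫⁻ x, (∫⁻ l in Ioi 1, F (x, l)) ∂κ := by
        refine lintegral_congr_ae ?_
        filter_upwards [hu, hv] with x hux hvx
        rw [ENNReal.ofReal_mul hux.le, ← lintegral_Ioi_inv_eq (by positivity),
          ← lintegral_const_mul]
        · refine lintegral_congr fun l => ?_
          simp only [F, indicator, mem_Iio, mem_ofPred_eq, lt_div_iff₀ hvx]
          split_ifs
          · rw [ENNReal.ofReal_mul hux.le]
          · simp
        · exact (measurable_id.inv.ennreal_ofReal).indicator measurableSet_Iio
    _ = ∫⁻ l in Ioi 1, ∫⁻ x, F (x, l) ∂κ := lintegral_lintegral_swap (f := fun x l => F (x, l)) hF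
    _ ≤ _ := by
        refine lintegral_mono_ae ((ae_restrict_iff' measurableSet_Ioi).2
          (ae_of_all _ fun l hl => ?_))
        have hl1 : (1 : ℝ) < l := hl
        have hl0 : (0 : ℝ) < l := one_pos.trans hl1
        calc ∫⁻ x, F (x, l) ∂κ
            ≤ ∫⁻ x, {x | (x, l) ∈ S}.indicator (fun x => ENNReal.ofReal (u x * l⁻¹)) x ∂κ := by
              refine lintegral_mono_ae ?_
              filter_upwards [hout l hl1] with x hx
              by_cases hxl : (x, l) ∈ S
              · rw [indicator_of_mem (show x ∈ {x | (x, l) ∈ S} from hxl)]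
                exact indicator_le_self _ _ (x, l)
              · have : (x, l) ∉ {p : X × ℝ | p.2 * v p.1 < u p.1} := not_lt.2 (hx hxl)
                simp [F, indicator_of_notMem this]
          _ = ENNReal.ofReal ((∫ x in {x | (x, l) ∈ S}, u x ∂κ) * l⁻¹) := by
              rw [lintegral_indicator (hSl l), ← integral_mul_const,
                ofReal_integral_eq_lintegral_ofReal (hui.integrableOn.mul_const _)]
              filter_upwards [ae_restrict_of_ae hu] with x hx
              exact mul_nonneg hx.le (inv_nonneg.2 hl0.le)
          _ ≤ _ := by
              refine ENNReal.ofReal_le_ofReal ?_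
              rw [← div_eq_mul_inv, div_le_iff₀ hl0, mul_comm]
              exact hmean l hl1

/-- The sharp passage from reverse Jensen inequalities on superlevel sets to an entropy bound. -/
theorem integral_mul_log_div_le_of_superlevel {Q : ℝ} (hQ : 0 < Q)
    (hu : ∀ᵐ x ∂κ, 0 < u x) (hv : ∀ᵐ x ∂κ, 0 < v x) (hui : Integrable u κ) (hvi : Integrable v κ)
    (hlogi : Integrable (fun x => v x * Real.log (u x / v x)) κ)
    (huv : ∫ x, u x ∂κ = ∫ x, v x ∂κ)
    {S : Set (X × ℝ)} (hS : MeasurableSet S)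
    (h0 : -Real.log Q * ∫ x, v x ∂κ ≤ ∫ x, v x * Real.log (u x / v x) ∂κ)
    (hl : ∀ l : ℝ, 1 < l → (Real.log l - Real.log Q) * ∫ x in {x | (x, l) ∈ S}, v x ∂κ ≤
      ∫ x in {x | (x, l) ∈ S}, v x * Real.log (u x / v x) ∂κ)
    (hout : ∀ l : ℝ, 1 < l → ∀ᵐ x ∂κ, (x, l) ∉ S → u x ≤ l * v x)
    (hmean : ∀ l : ℝ, 1 < l → ∫ x in {x | (x, l) ∈ S}, u x ∂κ ≤
      l * ∫ x in {x | (x, l) ∈ S}, v x ∂κ) :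
    Integrable (fun x => u x * Real.log (u x / v x)) κ ∧
      ∫ x, u x * Real.log (u x / v x) ∂κ ≤ Real.exp 1 * Q * ∫ x, v x ∂κ := by
  have hv0 : 0 ≤ ∫ x, v x ∂κ := integral_nonneg_of_ae (hv.mono fun x h => h.le)
  have hfin : ∀ T : ℝ, ∫⁻ l in Ioc 1 T, ENNReal.ofReal (∫ x in {x | (x, l) ∈ S}, v x ∂κ) ≤
      ENNReal.ofReal (Real.exp 1 * Q * ∫ x, v x ∂κ) := by
    intro T
    rw [← ofReal_integral_eq_lintegral_ofReal]
    · refine ENNReal.ofReal_le_ofReal ?_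
      have := setIntegral_measure_superlevel_le hQ hu hv hui hvi hlogi huv hS h0 hl T
      linarith
    · have hv' : Integrable (S.indicator fun p : X × ℝ => v p.1 * 1)
          (κ.prod (volume.restrict (Ioc 1 T))) :=
        (hvi.mul_prod (integrable_const (1 : ℝ))).indicator hS
      refine hv'.integral_prod_right.congr (ae_of_all _ fun l => ?_)
      simp only [mul_one]
      rw [← integral_indicator (show MeasurableSet {x | (x, l) ∈ S} from
        hS.preimage (by fun_prop))]
      rfl
    · exact ae_of_all _ fun l => integral_nonneg_of_ae
        ((ae_restrict_of_ae hv).mono fun x h => h.le)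
  have hbound : ∫⁻ x, ENNReal.ofReal (u x * Real.log (u x / v x)) ∂κ ≤
      ENNReal.ofReal (Real.exp 1 * Q * ∫ x, v x ∂κ) := by
    refine (lintegral_mul_log_div_le hu hv hui hvi hS hout hmean).trans ?_
    -- The bound `hfin` does not depend on T, so it passes to the increasing union.
    have hU : Ioi (1 : ℝ) = ⋃ n : ℕ, Ioc 1 (n : ℝ) := by
      ext x
      simp only [mem_Ioi, mem_iUnion, mem_Ioc, exists_and_left]
      exact ⟨fun h => ⟨h, exists_nat_ge x⟩, fun h => h.1⟩
    rw [hU, setLIntegral_iUnion_of_directed]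
    · exact iSup_le fun n => hfin n
    · exact (monotone_nat_of_le_succ fun n => Ioc_subset_Ioc_right (by simp)).directed_le
  have hmeas : AEStronglyMeasurable (fun x => u x * Real.log (u x / v x)) κ :=
    (hui.1.aemeasurable.mul (hui.1.aemeasurable.div hvi.1.aemeasurable).log).aestronglyMeasurable
  -- From log t ≥ 1 − 1/t one gets u log(u/v) ≥ u − v. The negative part is thus dominated by v, and
  -- integrability only needs the bound on the positive part.
  have hneg : ∀ᵐ x ∂κ, -v x ≤ u x * Real.log (u x / v x) := by
    filter_upwards [hu, hv] with x hux hvx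
    have h1 := Real.one_sub_inv_le_log_of_pos (div_pos hux hvx)
    have h2 : u x * (1 - (u x / v x)⁻¹) = u x - v x := by field_simp
    nlinarith
  have hpos : Integrable (fun x => max (u x * Real.log (u x / v x)) 0) κ := by
    refine ⟨hmeas.sup aestronglyMeasurable_const, ?_⟩
    refine (hasFiniteIntegral_iff_ofReal (ae_of_all _ fun x => le_max_right _ _)).2 ?_
    refine lt_of_le_of_lt ?_ (hbound.trans_lt ENNReal.ofReal_lt_top)
    refine lintegral_mono fun x => ?_
    exact (ofReal_max_zero _).le
  have hint : Integrable (fun x => u x * Real.log (u x / v x)) κ := by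
    refine (hpos.add hvi).mono' hmeas ?_
    filter_upwards [hneg, hv] with x hx hvx
    rw [Real.norm_eq_abs, abs_le]
    constructor
    · have := le_max_right (u x * Real.log (u x / v x)) 0
      simp only [Pi.add_apply]
      linarith
    · have := le_max_left (u x * Real.log (u x / v x)) 0
      simp only [Pi.add_apply]
      linarith
  refine ⟨hint, ?_⟩
  calc ∫ x, u x * Real.log (u x / v x) ∂κ
      ≤ ∫ x, max (u x * Real.log (u x / v x)) 0 ∂κ :=
        integral_mono hint hpos fun x => le_max_left _ _
    _ = (∫⁻ x, ENNReal.ofReal (u x * Real.log (u x / v x)) ∂κ).toReal := by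
        refine (integral_eq_lintegral_of_nonneg_ae
          (ae_of_all _ fun x => le_max_right _ _) hpos.1).trans ?_
        congr 1
        refine lintegral_congr fun x => ?_
        exact ofReal_max_zero _
    _ ≤ _ := ENNReal.toReal_le_of_le_ofReal (by positivity) hbound

end Abstract

/-! ### Components of open sets and the rising sun lemma. -/

/-- The connected components of a bounded open subset of the line are open intervals whose
endpoints lie outside the set. -/
theorem exists_connectedComponentIn_eq_Ioo {U : Set ℝ} (hU : IsOpen U) {a b : ℝ}
    (hab : U ⊆ Ioo a b) {x : ℝ} (hx : x ∈ U) :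
    ∃ c d, c < d ∧ a ≤ c ∧ d ≤ b ∧ c ∉ U ∧ d ∉ U ∧ connectedComponentIn U x = Ioo c d := by
  set I := connectedComponentIn U x with hI
  have hIo : IsOpen I := hU.connectedComponentIn
  have hIU : I ⊆ U := connectedComponentIn_subset U x
  have hxI : x ∈ I := mem_connectedComponentIn hx
  have hIc : IsPreconnected I := isPreconnected_connectedComponentIn
  have hba : BddAbove I := ⟨b, fun y hy => (hab (hIU hy)).2.le⟩
  have hbb : BddBelow I := ⟨a, fun y hy => (hab (hIU hy)).1.le⟩
  have hsub : Ioo (sInf I) (sSup I) ⊆ I := IsConnected.Ioo_csInf_csSup_subset ⟨⟨x, hxI⟩, hIc⟩ hbb hba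
  have hinf : sInf I ∉ I := fun h => by
    obtain ⟨e, he, hs⟩ := Metric.isOpen_iff.1 hIo _ h
    have : sInf I - e / 2 ∈ I := hs (by simp [abs_of_pos he, he])
    linarith [csInf_le hbb this]
  have hsup : sSup I ∉ I := fun h => by
    obtain ⟨e, he, hs⟩ := Metric.isOpen_iff.1 hIo _ h
    have : sSup I + e / 2 ∈ I := hs (by simp [abs_of_pos he, he])
    linarith [le_csSup hba this]
  have hIeq : I = Ioo (sInf I) (sSup I) := by
    refine Subset.antisymm (fun y hy => ⟨?_, ?_⟩) hsub
    · exact lt_of_le_of_ne (csInf_le hbb hy) fun h => hinf (h ▸ hy)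
    · exact lt_of_le_of_ne (le_csSup hba hy) fun h => hsup (h ▸ hy)
  have hxo : x ∈ Ioo (sInf I) (sSup I) := hIeq ▸ hxI
  refine ⟨sInf I, sSup I, hxo.1.trans hxo.2, le_csInf ⟨x, hxI⟩ fun y hy => (hab (hIU hy)).1.le,
    csSup_le ⟨x, hxI⟩ fun y hy => (hab (hIU hy)).2.le, fun h => hinf ?_, fun h => hsup ?_, hIeq⟩
  · have hpre : IsPreconnected (Ico (sInf I) (sSup I)) := isPreconnected_Ico
    refine hpre.subset_connectedComponentIn (x := x) ⟨hxo.1.le, hxo.2⟩ ?_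
      ⟨le_rfl, hxo.1.trans hxo.2⟩
    intro y hy
    rcases hy.1.eq_or_lt with h' | h'
    · exact h' ▸ h
    · exact hIU (hsub ⟨h', hy.2⟩)
  · have hpre : IsPreconnected (Ioc (sInf I) (sSup I)) := isPreconnected_Ioc
    refine hpre.subset_connectedComponentIn (x := x) ⟨hxo.1, hxo.2.le⟩ ?_
      ⟨hxo.1.trans hxo.2, le_rfl⟩
    intro y hy
    rcases hy.2.eq_or_lt with h' | h'
    · exact h' ▸ h
    · exact hIU (hsub ⟨hy.1, h'⟩)

/-- The components are disjoint nonempty open sets, hence countably many, so the integral is a sum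
over them. This carries inequalities known on intervals over to the shadow sets. -/
theorem setIntegral_nonneg_of_components {U : Set ℝ} (hU : IsOpen U) {a b : ℝ}
    (hab : U ⊆ Ioo a b) {f : ℝ → ℝ} (hf : IntegrableOn f U)
    (h : ∀ c d, c < d → a ≤ c → d ≤ b → Ioo c d ⊆ U → c ∉ U → d ∉ U →
      0 ≤ ∫ x in Ioo c d, f x) : 0 ≤ ∫ x in U, f x := by
  let 𝒞 : Set (Set ℝ) := (connectedComponentIn U) '' U
  have hopen : ∀ s ∈ 𝒞, IsOpen s := by
    rintro _ ⟨x, -, rfl⟩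
    exact hU.connectedComponentIn
  have hdisj : 𝒞.PairwiseDisjoint id := by
    rintro _ ⟨x, hx, rfl⟩ _ ⟨y, hy, rfl⟩ hne
    refine disjoint_left.2 fun z hzx hzy => hne ?_
    exact (connectedComponentIn_eq hzx).trans (connectedComponentIn_eq hzy).symm
  have hcount : 𝒞.Countable := hdisj.countable_of_isOpen hopen (by
    rintro _ ⟨x, hx, rfl⟩
    exact ⟨x, mem_connectedComponentIn hx⟩)
  have hUeq : U = ⋃ s ∈ 𝒞, s := by
    ext x
    simp only [mem_iUnion, exists_prop]
    constructor
    · exact fun hx => ⟨_, ⟨x, hx, rfl⟩, mem_connectedComponentIn hx⟩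
    · rintro ⟨_, ⟨y, hy, rfl⟩, hx⟩
      exact connectedComponentIn_subset U y hx
  have : Countable 𝒞 := hcount.to_subtype
  have hUeq' : U = ⋃ s : 𝒞, (s : Set ℝ) := by rw [hUeq, biUnion_eq_iUnion]
  rw [hUeq'] at hf ⊢
  rw [integral_iUnion (s := fun s : 𝒞 => (s : Set ℝ)) (fun s => (hopen s s.2).measurableSet)
    (fun s t hst => hdisj s.2 t.2 fun h => hst (Subtype.ext h)) hf]
  refine tsum_nonneg ?_
  rintro ⟨_, ⟨x, hx, rfl⟩⟩
  obtain ⟨c, d, hcd, hac, hdb, hc, hd, he⟩ := exists_connectedComponentIn_eq_Ioo hU hab hx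
  simp only [he]
  exact h c d hcd hac hdb (he ▸ connectedComponentIn_subset U x) hc hd

/-- The set where the graph of `φ` over `(a, b)` lies in the shadow cast from the right by the
maximum of `φ` and the constant `φ a = 0`. -/
def shadow (φ : ℝ → ℝ) (a b : ℝ) : Set ℝ :=
  {x | x ∈ Ioo a b ∧ ∃ y ∈ Ioc x b, φ x < φ y ∨ 0 < φ y}

/-- A form of the rising sun lemma with equality on every component. -/
theorem eq_of_shadow_component {φ : ℝ → ℝ} (hφ : Continuous φ) {a b : ℝ}
    (ha : φ a = 0) (hb : φ b ≤ 0) {c d : ℝ} (hcd : c < d) (hac : a ≤ c) (hdb : d ≤ b)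
    (hsub : Ioo c d ⊆ shadow φ a b) (hc : c ∉ shadow φ a b) (hd : d ∉ shadow φ a b) :
    φ c = φ d := by
  have hdy : ∀ y ∈ Ioc d b, φ y ≤ φ d ∧ φ y ≤ 0 := by
    intro y hy
    by_contra hcon
    refine hd ⟨⟨hac.trans_lt hcd, hy.1.trans_le hy.2⟩, y, hy, ?_⟩
    rw [not_and_or, not_le, not_le] at hcon
    exact hcon
  have hd0 : φ d ≤ 0 := by
    rcases hdb.eq_or_lt with h | h
    · exact h ▸ hb
    · by_contra hcon
      have hev : ∀ᶠ y in nhdsWithin d (Ioi d), 0 < φ y :=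
        (hφ.continuousAt.continuousWithinAt).eventually (lt_mem_nhds (not_le.1 hcon))
      have hev2 : ∀ᶠ y in nhdsWithin d (Ioi d), y ∈ Ioc d b := Ioc_mem_nhdsGT h
      obtain ⟨y, hy1, hy2⟩ := (hev.and hev2).exists
      exact absurd (hdy y hy2).2 (not_le.2 hy1)
  have hmin : ∀ x ∈ Ioo c d, min (φ x) 0 ≤ φ d := by
    intro x hx
    by_contra hcon
    rw [not_le] at hcon
    set m := min (φ x) 0
    -- Take the last z in [x, d] with φ z ≥ m. It lies in the shadow, so some y > z has φ y ≥ m; y ≤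
    -- d contradicts maximality of z, and y > d contradicts φ y ≤ φ d < m.
    have hcomp : IsCompact (Icc x d ∩ φ ⁻¹' Ici m) :=
      isCompact_Icc.inter_right (isClosed_Ici.preimage hφ)
    obtain ⟨z, ⟨hzI, hzm⟩, hzmax⟩ := hcomp.exists_isGreatest
      ⟨x, ⟨le_rfl, hx.2.le⟩, min_le_left (φ x) 0⟩
    have hzm' : m ≤ φ z := hzm
    have hzd : z < d := lt_of_le_of_ne hzI.2 fun h => by
      rw [h] at hzm'
      linarith
    obtain ⟨-, y, hy, hyz⟩ := hsub ⟨hx.1.trans_le hzI.1, hzd⟩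
    have hmy : m ≤ φ y := by
      rcases hyz with h | h
      · linarith
      · exact (min_le_right _ _).trans h.le
    rcases le_or_gt y d with h | h
    · exact absurd (hzmax ⟨⟨hzI.1.trans hy.1.le, h⟩, hmy⟩) (not_le.2 hy.1)
    · linarith [(hdy y ⟨h, hy.2⟩).1]
  have hminc : min (φ c) 0 ≤ φ d := by
    have hcl : c ∈ closure (Ioo c d) := by
      rw [closure_Ioo hcd.ne]
      exact ⟨le_rfl, hcd.le⟩
    exact closure_minimal (s := Ioo c d) (t := {x | min (φ x) 0 ≤ φ d}) hmin
      (isClosed_le (hφ.min continuous_const) continuous_const) hcl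
  -- If c = a, the usual shadow would give only φ a ≤ φ d. The clause `0 < φ y` in `shadow` supplies
  -- φ d ≤ 0 = φ a.
  rcases hac.eq_or_lt with h | h
  · subst h
    rw [ha, min_self] at hminc
    rw [ha]
    exact le_antisymm hminc hd0
  · have hcy : ∀ y ∈ Ioc c b, φ y ≤ φ c ∧ φ y ≤ 0 := by
      intro y hy
      by_contra hcon
      refine hc ⟨⟨h, hy.1.trans_le hy.2⟩, y, hy, ?_⟩
      rw [not_and_or, not_le, not_le] at hcon
      exact hcon
    have hc0 : φ c ≤ 0 := by
      have hcl : c ∈ closure (Ioo c d) := by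
        rw [closure_Ioo hcd.ne]
        exact ⟨le_rfl, hcd.le⟩
      exact closure_minimal (s := Ioo c d) (t := {x | φ x ≤ 0})
        (fun y hy => (hcy y ⟨hy.1, hy.2.le.trans hdb⟩).2) (isClosed_le hφ continuous_const) hcl
    rw [min_eq_left hc0] at hminc
    exact le_antisymm hminc (hcy d ⟨hcd, hdb⟩).1

/-- Openness jointly in the point and the level makes the family of shadows measurable on the
product, as Fubini requires. -/
theorem isOpen_shadow_family {Φ : ℝ × ℝ → ℝ} (hΦ : Continuous Φ) (a b : ℝ) :
    IsOpen {p : ℝ × ℝ | p.1 ∈ shadow (fun x => Φ (x, p.2)) a b} := by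
  have : {p : ℝ × ℝ | p.1 ∈ shadow (fun x => Φ (x, p.2)) a b} =
      {p : ℝ × ℝ | a < p.1} ∩ {p : ℝ × ℝ | p.1 < b} ∩ ⋃ y ∈ Iic b, ({p : ℝ × ℝ | p.1 < y} ∩
        ({p : ℝ × ℝ | Φ p < Φ (y, p.2)} ∪ {p : ℝ × ℝ | 0 < Φ (y, p.2)})) := by
    ext ⟨x, l⟩
    simp [shadow, and_assoc]
  rw [this]
  refine ((isOpen_lt (by fun_prop) (by fun_prop)).inter
    (isOpen_lt (by fun_prop) (by fun_prop))).inter (isOpen_biUnion fun y _ => ?_)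
  exact (isOpen_lt (by fun_prop) (by fun_prop)).inter
    ((isOpen_lt (by fun_prop) (by fun_prop)).union (isOpen_lt (by fun_prop) (by fun_prop)))

theorem intervalIntegral_indicator_sub {f : ℝ → ℝ} {a b : ℝ} (hf : IntegrableOn f (Ioo a b))
    {c d : ℝ} (hac : a ≤ c) (hcd : c ≤ d) (hdb : d ≤ b) :
    (∫ x in a..d, (Ioo a b).indicator f x) - ∫ x in a..c, (Ioo a b).indicator f x =
      ∫ x in Ioo c d, f x := by
  have hi : Integrable ((Ioo a b).indicator f) := hf.integrable_indicator measurableSet_Ioo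
  rw [intervalIntegral.integral_interval_sub_left hi.intervalIntegrable hi.intervalIntegrable,
    intervalIntegral.integral_of_le hcd, integral_Ioc_eq_integral_Ioo]
  exact setIntegral_congr_fun measurableSet_Ioo fun x hx =>
    indicator_of_mem (show x ∈ Ioo a b from ⟨hac.trans_lt hx.1, hx.2.trans_le hdb⟩) f

/-- A reverse Jensen inequality for the logarithm on all subintervals implies an entropy bound. -/
theorem integral_mul_log_div_le_of_reverse_jensen {u v : ℝ → ℝ} {a b Q : ℝ} (hab : a < b)
    (hQ : 0 < Q) (hu : IntegrableOn u (Ioo a b)) (hv : IntegrableOn v (Ioo a b))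
    (hu0 : ∀ᵐ x ∂volume.restrict (Ioo a b), 0 < u x)
    (hv0 : ∀ᵐ x ∂volume.restrict (Ioo a b), 0 < v x)
    (hlog : IntegrableOn (fun x => v x * Real.log (u x / v x)) (Ioo a b))
    (huv : ∫ x in Ioo a b, u x = ∫ x in Ioo a b, v x)
    (hJ : ∀ c d, a ≤ c → c < d → d ≤ b → ∀ l, ∫ x in Ioo c d, u x = l * ∫ x in Ioo c d, v x →
      (Real.log l - Real.log Q) * ∫ x in Ioo c d, v x ≤
        ∫ x in Ioo c d, v x * Real.log (u x / v x)) :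
    IntegrableOn (fun x => u x * Real.log (u x / v x)) (Ioo a b) ∧
      ∫ x in Ioo a b, u x * Real.log (u x / v x) ≤ Real.exp 1 * Q * ∫ x in Ioo a b, v x := by
  have hui : Integrable ((Ioo a b).indicator u) := hu.integrable_indicator measurableSet_Ioo
  have hvi : Integrable ((Ioo a b).indicator v) := hv.integrable_indicator measurableSet_Ioo
  have hvnn : 0 ≤ ∫ x in Ioo a b, v x := integral_nonneg_of_ae (hv0.mono fun x h => h.le)
  let Fu : ℝ → ℝ := fun x => ∫ t in a..x, (Ioo a b).indicator u t
  let Fv : ℝ → ℝ := fun x => ∫ t in a..x, (Ioo a b).indicator v t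
  have hFu : Continuous Fu := intervalIntegral.continuous_primitive
    (fun _ _ => hui.intervalIntegrable) a
  have hFv : Continuous Fv := intervalIntegral.continuous_primitive
    (fun _ _ => hvi.intervalIntegrable) a
  let Φ : ℝ × ℝ → ℝ := fun p => Fu p.1 - p.2 * Fv p.1
  have hΦ : Continuous Φ := by fun_prop
  have hφ : ∀ l, Continuous fun x => Φ (x, l) := fun l => by fun_prop
  have hφa : ∀ l, Φ (a, l) = 0 := fun l => by simp [Φ, Fu, Fv]
  have hφcd : ∀ l c d, a ≤ c → c ≤ d → d ≤ b → Φ (d, l) - Φ (c, l) =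
      (∫ x in Ioo c d, u x) - l * ∫ x in Ioo c d, v x := by
    intro l c d hac hcd hdb
    rw [← intervalIntegral_indicator_sub hu hac hcd hdb,
      ← intervalIntegral_indicator_sub hv hac hcd hdb]
    simp only [Φ, Fu, Fv]
    ring
  have hφb : ∀ l, 1 < l → Φ (b, l) ≤ 0 := by
    intro l hl
    have := hφcd l a b le_rfl hab.le le_rfl
    rw [hφa, huv] at this
    nlinarith
  let Ω : ℝ → Set ℝ := fun l => shadow (fun x => Φ (x, l)) a b
  have hSopen := isOpen_shadow_family hΦ a b
  have hΩo : ∀ l, IsOpen (Ω l) := fun l => hSopen.preimage (by fun_prop : Continuous fun x => (x, l))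
  have hΩs : ∀ l, Ω l ⊆ Ioo a b := fun l x hx => hx.1
  have hres : ∀ l (f : ℝ → ℝ), ∫ x in {x | (x, l) ∈ {p : ℝ × ℝ |
      p.1 ∈ shadow (fun x => Φ (x, p.2)) a b}}, f x ∂(volume.restrict (Ioo a b)) =
      ∫ x in Ω l, f x := by
    intro l f
    have : (volume.restrict (Ioo a b)).restrict (Ω l) = volume.restrict (Ω l) := by
      rw [Measure.restrict_restrict (hΩo l).measurableSet, inter_eq_left.2 (hΩs l)]
    rw [← this]
    rfl
  have hcomp : ∀ l, 1 < l → ∀ c d, c < d → a ≤ c → d ≤ b → Ioo c d ⊆ Ω l → c ∉ Ω l → d ∉ Ω l →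
      ∫ x in Ioo c d, u x = l * ∫ x in Ioo c d, v x := by
    intro l hl c d hcd hac hdb hsub hc hd
    have h1 := eq_of_shadow_component (hφ l) (hφa l) (hφb l hl) hcd hac hdb hsub hc hd
    have h2 := hφcd l c d hac hcd.le hdb
    linarith
  refine integral_mul_log_div_le_of_superlevel hQ hu0 hv0 hu hv hlog huv
    hSopen.measurableSet ?_ ?_ ?_ ?_
  · have := hJ a b le_rfl hab le_rfl 1 (by rw [one_mul, huv])
    simpa using this
  · intro l hl
    rw [hres, hres]
    have h1 : IntegrableOn v (Ω l) := hv.mono_set (hΩs l)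
    have h2 : IntegrableOn (fun x => v x * Real.log (u x / v x)) (Ω l) := hlog.mono_set (hΩs l)
    have := setIntegral_nonneg_of_components (hΩo l) (hΩs l)
      (h2.sub (h1.const_mul (Real.log l - Real.log Q))) (fun c d hcd hac hdb hsub hc hd => by
        have h1' := h1.mono_set hsub
        have h2' := h2.mono_set hsub
        have e : ∫ x in Ioo c d, (v x * Real.log (u x / v x) - (Real.log l - Real.log Q) * v x) =
            (∫ x in Ioo c d, v x * Real.log (u x / v x)) -
              ∫ x in Ioo c d, (Real.log l - Real.log Q) * v x :=
          integral_sub h2' (h1'.const_mul _)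
        refine le_of_le_of_eq ?_ e.symm
        rw [integral_const_mul, sub_nonneg]
        exact hJ c d hac hcd hdb l (hcomp l hl c d hcd hac hdb hsub hc hd))
    have e : ∫ x in Ω l, (v x * Real.log (u x / v x) - (Real.log l - Real.log Q) * v x) =
        (∫ x in Ω l, v x * Real.log (u x / v x)) - ∫ x in Ω l, (Real.log l - Real.log Q) * v x :=
      integral_sub h2 (h1.const_mul _)
    rw [← sub_nonneg, ← integral_const_mul]
    exact this.trans_eq e
  · intro l hl
    -- Off the shadow φ_l never exceeds its value at x further to the right, so its right slopes are
    -- nonpositive. By Lebesgue differentiation their limit is u − l v a.e.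
    filter_upwards [ae_restrict_of_ae (LocallyIntegrable.ae_hasDerivAt_integral hui.locallyIntegrable),
      ae_restrict_of_ae (LocallyIntegrable.ae_hasDerivAt_integral hvi.locallyIntegrable),
      ae_restrict_mem measurableSet_Ioo] with x hxu hxv hx hxS
    have hder : HasDerivAt (fun x => Φ (x, l))
        ((Ioo a b).indicator u x - l * (Ioo a b).indicator v x) x :=
      (hxu a).sub ((hxv a).const_mul l)
    rw [indicator_of_mem hx, indicator_of_mem hx] at hder
    have hle : u x - l * v x ≤ 0 := by
      have ht := hasDerivAt_iff_tendsto_slope_left_right.1 hder |>.2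
      refine le_of_tendsto ht ?_
      filter_upwards [Ioc_mem_nhdsGT hx.2] with y hy
      have : Φ (y, l) ≤ Φ (x, l) := by
        by_contra hcon
        exact hxS ⟨hx, y, hy, Or.inl (not_le.1 hcon)⟩
      rw [slope_def_field]
      exact div_nonpos_of_nonpos_of_nonneg (sub_nonpos.2 this) (sub_nonneg.2 hy.1.le)
    linarith
  · intro l hl
    rw [hres, hres]
    have h1 : IntegrableOn v (Ω l) := hv.mono_set (hΩs l)
    have h2 : IntegrableOn u (Ω l) := hu.mono_set (hΩs l)
    have := setIntegral_nonneg_of_components (hΩo l) (hΩs l)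
      ((h1.const_mul l).sub h2) (fun c d hcd hac hdb hsub hc hd => by
        have e : ∫ x in Ioo c d, (l * v x - u x) =
            (∫ x in Ioo c d, l * v x) - ∫ x in Ioo c d, u x :=
          integral_sub ((h1.mono_set hsub).const_mul l) (h2.mono_set hsub)
        refine le_of_le_of_eq ?_ e.symm
        rw [integral_const_mul, hcomp l hl c d hcd hac hdb hsub hc hd, sub_self])
    have e : ∫ x in Ω l, (l * v x - u x) = (∫ x in Ω l, l * v x) - ∫ x in Ω l, u x :=
      integral_sub (h1.const_mul l) h2
    rw [← sub_nonneg, ← integral_const_mul]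
    exact this.trans_eq e

/-! ### The two comparisons between the constants of a weight. -/

theorem intervalMean_eq {f : ℝ → ℝ} {a b : ℝ} (hab : a < b) :
    intervalMean f a b = (∫ x in Ioo a b, f x) / (b - a) := by
  rw [intervalMean, setAverage_eq, integral_Icc_eq_integral_Ioo, smul_eq_mul, measureReal_def,
    Real.volume_Icc, ENNReal.toReal_ofReal (sub_pos.2 hab).le, div_eq_inv_mul]

theorem integral_Ioo_eq_mul_intervalMean {f : ℝ → ℝ} {a b : ℝ} (hab : a < b) :
    ∫ x in Ioo a b, f x = (b - a) * intervalMean f a b := by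
  rw [intervalMean_eq hab, mul_div_cancel₀ _ (sub_pos.2 hab).ne']

theorem IsWeight.integrableOn_Icc {w : ℝ → ℝ} (hw : IsWeight w) (a b : ℝ) :
    IntegrableOn w (Icc a b) :=
  hw.1.integrableOn_isCompact isCompact_Icc

theorem IsWeight.integrableOn_Ioo {w : ℝ → ℝ} (hw : IsWeight w) (a b : ℝ) :
    IntegrableOn w (Ioo a b) :=
  (hw.integrableOn_Icc a b).mono_set Ioo_subset_Icc_self

theorem IsWeight.integral_Ioo_pos {w : ℝ → ℝ} (hw : IsWeight w) {a b : ℝ} (hab : a < b) :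
    0 < ∫ x in Ioo a b, w x := by
  have hpos : ∀ᵐ x ∂volume.restrict (Ioo a b), 0 < w x := ae_restrict_of_ae hw.2
  rw [integral_pos_iff_support_of_nonneg_ae (hpos.mono fun x h => h.le) (hw.integrableOn_Ioo a b)]
  have : Function.support w =ᵐ[volume.restrict (Ioo a b)] (univ : Set ℝ) := by
    filter_upwards [hpos] with x hx
    exact propext (iff_of_true hx.ne' trivial)
  rw [measure_congr this, Measure.restrict_apply_univ, Real.volume_Ioo, ENNReal.ofReal_pos]
  exact sub_pos.2 hab

theorem IsWeight.intervalMean_pos {w : ℝ → ℝ} (hw : IsWeight w) {a b : ℝ} (hab : a < b) :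
    0 < intervalMean w a b := by
  rw [intervalMean_eq hab]
  exact div_pos (hw.integral_Ioo_pos hab) (sub_pos.2 hab)

theorem integral_Ioo_const {a b : ℝ} (hab : a < b) (c : ℝ) :
    ∫ _ in Ioo a b, c = (b - a) * c := by
  simp [measureReal_def, (sub_pos.2 hab).le]

theorem integrableOn_log_of_aInftyConst_lt_top {w : ℝ → ℝ} (h : aInftyConst w < ⊤) {a b : ℝ}
    (hab : a < b) : IntegrableOn (fun x => Real.log (w x)) (Icc a b) := by
  by_contra hcon
  have h1 : aInftyOn w a b ≤ aInftyConst w :=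
    le_iSup_of_le a (le_iSup_of_le b (le_iSup_of_le hab le_rfl))
  rw [aInftyOn, if_neg hcon] at h1
  exact absurd h1 (not_le.2 h)

theorem intervalMean_mul_exp_le {w : ℝ → ℝ} (h : aInftyConst w < ⊤) {a b : ℝ} (hab : a < b) :
    intervalMean w a b * Real.exp (-intervalMean (fun x => Real.log (w x)) a b) ≤
      (aInftyConst w).toReal := by
  have h1 : aInftyOn w a b ≤ aInftyConst w :=
    le_iSup_of_le a (le_iSup_of_le b (le_iSup_of_le hab le_rfl))
  rw [aInftyOn, if_pos (integrableOn_log_of_aInftyConst_lt_top h hab)] at h1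
  exact (ENNReal.ofReal_le_iff_le_toReal h.ne).1 h1

theorem log_intervalMean_sub_le {w : ℝ → ℝ} (hw : IsWeight w) (h : aInftyConst w < ⊤) {a b : ℝ}
    (hab : a < b) : Real.log (intervalMean w a b) - Real.log (aInftyConst w).toReal ≤
      intervalMean (fun x => Real.log (w x)) a b := by
  have h1 := intervalMean_mul_exp_le h hab
  have hm := hw.intervalMean_pos hab
  have h2 := Real.log_le_log (mul_pos hm (Real.exp_pos _)) h1
  rw [Real.log_mul hm.ne' (Real.exp_pos _).ne', Real.log_exp] at h2
  linarith

/-- The sharp bound of the `L log L` constant by the `A_∞` constant. -/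
theorem rhOneConst_le {w : ℝ → ℝ} (hw : IsWeight w) :
    rhOneConst w ≤ ENNReal.ofReal (Real.exp 1) * aInftyConst w := by
  rcases eq_or_ne (aInftyConst w) ⊤ with htop | hne
  · rw [htop, ENNReal.mul_top (by simp [Real.exp_pos])]
    exact le_top
  have h : aInftyConst w < ⊤ := lt_top_iff_ne_top.2 hne
  set Q := (aInftyConst w).toReal with hQdef
  have hQ : 0 < Q := lt_of_lt_of_le (mul_pos (hw.intervalMean_pos one_pos) (Real.exp_pos _))
    (intervalMean_mul_exp_le h (one_pos : (0 : ℝ) < 1))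
  refine iSup_le fun a => iSup_le fun b => iSup_le fun hab => ?_
  set m := intervalMean w a b with hm
  have hm0 : 0 < m := hw.intervalMean_pos hab
  have hwint := hw.integrableOn_Ioo a b
  have hlogw : ∀ c d, c < d → IntegrableOn (fun x => Real.log (w x)) (Ioo c d) := fun c d hcd =>
    (integrableOn_log_of_aInftyConst_lt_top h hcd).mono_set Ioo_subset_Icc_self
  have hlogeq : ∀ c d, (fun x => (1 : ℝ) * Real.log (w x / m / 1)) =ᵐ[volume.restrict (Ioo c d)]
      fun x => Real.log (w x) - Real.log m := by
    intro c d
    filter_upwards [ae_restrict_of_ae hw.2] with x hx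
    rw [one_mul, div_one, Real.log_div hx.ne' hm0.ne']
  obtain ⟨hi, hle⟩ := integral_mul_log_div_le_of_reverse_jensen (u := fun x => w x / m)
    (v := fun _ => (1 : ℝ)) hab hQ (hwint.div_const m) (integrableOn_const (by simp))
    (by filter_upwards [ae_restrict_of_ae hw.2] with x hx using div_pos hx hm0)
    (ae_of_all _ fun _ => one_pos)
    (((hlogw a b hab).sub (integrableOn_const (by simp))).congr (hlogeq a b).symm)
    (by
      rw [integral_div, integral_Ioo_eq_mul_intervalMean hab, ← hm, integral_Ioo_const hab]
      field_simp)
    (by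
      intro c d hac hcd hdb l hl
      have hmcd := hw.intervalMean_pos hcd
      rw [integral_div, integral_Ioo_eq_mul_intervalMean hcd, integral_Ioo_const hcd] at hl
      have hdc : 0 < d - c := sub_pos.2 hcd
      have hl' : l = intervalMean w c d / m := by
        field_simp at hl ⊢
        linarith
      rw [integral_congr_ae (hlogeq c d), integral_sub (hlogw c d hcd)
        (integrableOn_const (by simp)), integral_Ioo_const hcd, integral_Ioo_const hcd,
        integral_Ioo_eq_mul_intervalMean hcd, hl', Real.log_div hmcd.ne' hm0.ne']
      have := log_intervalMean_sub_le hw h hcd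
      nlinarith)
  have hi' : IntegrableOn (rhOneIntegrand w a b) (Icc a b) := by
    rw [integrableOn_Icc_iff_integrableOn_Ioo]
    simp only [div_one] at hi
    exact hi
  rw [rhOneOn, if_pos hi', ← ENNReal.ofReal_toReal h.ne, ← ENNReal.ofReal_mul (Real.exp_pos 1).le,
    intervalMean_eq hab]
  refine ENNReal.ofReal_le_ofReal ?_
  rw [div_le_iff₀ (sub_pos.2 hab)]
  simp only [div_one] at hle
  rw [integral_Ioo_const hab, mul_one] at hle
  exact hle

/-- The same estimate with the roles exchanged: u is the constant m = m_J w and v = w. The RH_1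
bound R is then a reverse Jensen inequality with log Q = R, and the conclusion reads m_J log(m/w) ≤
e · exp R. -/
theorem aInftyConst_lt_top_of_rhOneConst_lt_top {w : ℝ → ℝ} (hw : IsWeight w)
    (h : rhOneConst w < ⊤) : aInftyConst w < ⊤ := by
  set R := (rhOneConst w).toReal with hR
  have hRH : ∀ c d, c < d → IntegrableOn (rhOneIntegrand w c d) (Ioo c d) ∧
      intervalMean (rhOneIntegrand w c d) c d ≤ R := by
    intro c d hcd
    have h1 : rhOneOn w c d ≤ rhOneConst w :=
      le_iSup_of_le c (le_iSup_of_le d (le_iSup_of_le hcd le_rfl))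
    have hi : IntegrableOn (rhOneIntegrand w c d) (Icc c d) := by
      by_contra hcon
      rw [rhOneOn, if_neg hcon] at h1
      exact absurd h1 (not_le.2 h)
    rw [rhOneOn, if_pos hi] at h1
    exact ⟨hi.mono_set Ioo_subset_Icc_self, (ENNReal.ofReal_le_iff_le_toReal h.ne).1 h1⟩
  suffices hmain : ∀ a b, a < b → aInftyOn w a b ≤
      ENNReal.ofReal (Real.exp (Real.exp 1 * Real.exp R)) from
    lt_of_le_of_lt (iSup_le fun a => iSup_le fun b => iSup_le fun hab => hmain a b hab)
      ENNReal.ofReal_lt_top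
  intro a b hab
  set m := intervalMean w a b with hm
  have hm0 : 0 < m := hw.intervalMean_pos hab
  have heq : ∀ c d, c < d → (fun x => w x * Real.log (m / w x)) =ᵐ[volume.restrict (Ioo c d)]
      fun x => w x * Real.log (m / intervalMean w c d) -
        intervalMean w c d * rhOneIntegrand w c d x := by
    intro c d hcd
    have hmcd := hw.intervalMean_pos hcd
    filter_upwards [ae_restrict_of_ae hw.2] with x hx
    rw [rhOneIntegrand, Real.log_div hm0.ne' hx.ne', Real.log_div hm0.ne' hmcd.ne',
      Real.log_div hx.ne' hmcd.ne']
    field_simp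
    ring
  obtain ⟨hi, hle⟩ := integral_mul_log_div_le_of_reverse_jensen (u := fun _ => m)
    (v := w) hab (Real.exp_pos R) (integrableOn_const (by simp)) (hw.integrableOn_Ioo a b)
    (ae_of_all _ fun _ => hm0) (ae_restrict_of_ae hw.2)
    ((((hw.integrableOn_Ioo a b).mul_const _).sub ((hRH a b hab).1.const_mul _)).congr
      (heq a b hab).symm)
    (by rw [integral_Ioo_const hab, integral_Ioo_eq_mul_intervalMean hab])
    (by
      intro c d hac hcd hdb l hl
      have hmcd := hw.intervalMean_pos hcd
      have hdc : 0 < d - c := sub_pos.2 hcd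
      rw [integral_Ioo_const hcd, integral_Ioo_eq_mul_intervalMean hcd] at hl
      have hl' : l = m / intervalMean w c d := by
        field_simp
        have : (d - c) * (l * intervalMean w c d) = (d - c) * m := by rw [hl]; ring
        exact mul_left_cancel₀ hdc.ne' this
      rw [integral_congr_ae (heq c d hcd), integral_sub ((hw.integrableOn_Ioo c d).mul_const _)
        ((hRH c d hcd).1.const_mul _), integral_mul_const, integral_const_mul,
        integral_Ioo_eq_mul_intervalMean hcd, integral_Ioo_eq_mul_intervalMean hcd, ← hl',
        Real.log_exp]
      have h3 : 0 < (d - c) * intervalMean w c d := mul_pos hdc hmcd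
      have := mul_le_mul_of_nonneg_left (hRH c d hcd).2 h3.le
      nlinarith)
  have hae : (fun x => Real.log (w x)) =ᵐ[volume.restrict (Ioo a b)]
      fun x => Real.log m - m⁻¹ * (m * Real.log (m / w x)) := by
    filter_upwards [ae_restrict_of_ae hw.2] with x hx
    rw [Real.log_div hm0.ne' hx.ne', inv_mul_cancel_left₀ hm0.ne']
    ring
  have hlog : IntegrableOn (fun x => Real.log (w x)) (Ioo a b) :=
    ((integrableOn_const (by simp)).sub (hi.const_mul _)).congr hae.symm
  have hlogI : IntegrableOn (fun x => Real.log (w x)) (Icc a b) := by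
    rwa [integrableOn_Icc_iff_integrableOn_Ioo]
  rw [aInftyOn, if_pos hlogI]
  refine ENNReal.ofReal_le_ofReal ?_
  have hba : 0 < b - a := sub_pos.2 hab
  have hmean : intervalMean (fun x => Real.log (w x)) a b = Real.log m -
      m⁻¹ * (∫ x in Ioo a b, m * Real.log (m / w x)) / (b - a) := by
    rw [intervalMean_eq hab, integral_congr_ae hae, integral_sub
      (integrable_const (μ := volume.restrict (Ioo a b)) (Real.log m)) (hi.const_mul _), integral_const_mul, integral_Ioo_const hab]
    field_simp
  rw [integral_Ioo_eq_mul_intervalMean (f := w) hab, ← hm] at hle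
  have hfin : m⁻¹ * (∫ x in Ioo a b, m * Real.log (m / w x)) / (b - a) ≤
      Real.exp 1 * Real.exp R := by
    rw [div_le_iff₀ hba, inv_mul_le_iff₀ hm0]
    linarith
  rw [hmean]
  calc m * Real.exp (-(Real.log m - m⁻¹ * (∫ x in Ioo a b, m * Real.log (m / w x)) / (b - a)))
      = Real.exp (m⁻¹ * (∫ x in Ioo a b, m * Real.log (m / w x)) / (b - a)) := by
        rw [neg_sub, Real.exp_sub, Real.exp_log hm0]
        field_simp
    _ ≤ _ := Real.exp_le_exp.2 hfin

theorem memAInfty_iff_memRHOne {w : ℝ → ℝ} (hw : IsWeight w) : MemAInfty w ↔ MemRHOne w :=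
  ⟨fun h => ⟨hw, (rhOneConst_le hw).trans_lt (ENNReal.mul_lt_top ENNReal.ofReal_lt_top h.2)⟩,
    fun h => ⟨hw, aInftyConst_lt_top_of_rhOneConst_lt_top hw h.2⟩⟩

/-! ### Splicing a rescaled periodic function with a constant. -/

theorem intervalIntegrable_of_measurable_of_abs_le {f : ℝ → ℝ} (hf : Measurable f) {C : ℝ}
    (hC : ∀ x, |f x| ≤ C) (a b : ℝ) : IntervalIntegrable f volume a b := by
  rw [intervalIntegrable_iff]
  exact Measure.integrableOn_of_bounded (M := C) (by simp) hf.aestronglyMeasurable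
    (ae_of_all _ hC)

theorem Function.Periodic.intervalIntegral_eq_fract {f : ℝ → ℝ} (hp : Function.Periodic f 1)
    (hi : ∀ a b, IntervalIntegrable f volume a b) (h0 : ∫ x in (0 : ℝ)..1, f x = 0) (t : ℝ) :
    ∫ x in (0 : ℝ)..t, f x = ∫ x in (0 : ℝ)..Int.fract t, f x := by
  have h1 := hp.intervalIntegral_add_zsmul_eq ⌊t⌋ (Int.fract t) hi
  have h2 : Int.fract t + ⌊t⌋ • (1 : ℝ) = t := by
    rw [zsmul_eq_mul, mul_one]
    exact Int.fract_add_floor t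
  rw [h2, hp.intervalIntegral_add_eq _ 0, zero_add, h0, smul_zero] at h1
  rw [← intervalIntegral.integral_add_adjacent_intervals (hi 0 (Int.fract t)) (hi _ t), h1,
    add_zero]

/-- The `1`-periodic function equal to `γ` near the integers and to a rescaled copy of `f` on
`[h, 1 - h]`. -/
noncomputable def splice (h k : ℝ) (f : ℝ → ℝ) (γ : ℝ) (x : ℝ) : ℝ :=
  if h ≤ Int.fract x ∧ Int.fract x ≤ 1 - h then f (k * Int.fract x - k * h) else γ

theorem comp_splice (φ : ℝ → ℝ) (h k : ℝ) (f : ℝ → ℝ) (γ x : ℝ) :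
    φ (splice h k f γ x) = splice h k (fun y => φ (f y)) (φ γ) x := by
  unfold splice
  split_ifs <;> rfl

theorem splice_periodic (h k : ℝ) (f : ℝ → ℝ) (γ : ℝ) : Function.Periodic (splice h k f γ) 1 := by
  intro x
  simp only [splice, Int.fract_add_one]

theorem measurable_splice (h k : ℝ) {f : ℝ → ℝ} (hf : Measurable f) (γ : ℝ) :
    Measurable (splice h k f γ) := by
  refine Measurable.ite ?_ (hf.comp ?_) measurable_const
  · exact (measurableSet_le measurable_const measurable_fract).inter
      (measurableSet_le measurable_fract measurable_const)
  · exact (measurable_fract.const_mul k).sub_const _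

theorem splice_mem {h k : ℝ} {f : ℝ → ℝ} {γ : ℝ} {s : Set ℝ} (hf : ∀ x, f x ∈ s) (hγ : γ ∈ s)
    (x : ℝ) : splice h k f γ x ∈ s := by
  unfold splice
  split_ifs
  exacts [hf _, hγ]

section Splice

variable {h k : ℝ} {f : ℝ → ℝ} {γ : ℝ}

theorem integral_splice_middle (h0 : 0 < h) (hk : 0 < k) {a b : ℝ} (ha : h ≤ a) (hab : a ≤ b)
    (hb : b ≤ 1 - h) : ∫ x in a..b, splice h k f γ x =
      k⁻¹ * ∫ x in (k * a - k * h)..(k * b - k * h), f x := by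
  rw [← smul_eq_mul, ← intervalIntegral.integral_comp_mul_sub f hk.ne']
  refine intervalIntegral.integral_congr fun x hx => ?_
  rw [uIcc_of_le hab] at hx
  have hfr : Int.fract x = x := Int.fract_eq_self.2 ⟨by linarith [hx.1], by linarith [hx.2]⟩
  simp only [splice, hfr]
  rw [if_pos ⟨ha.trans hx.1, hx.2.trans hb⟩]

theorem integral_splice_end (hh : h < 1 / 2) {a b : ℝ} (ha : -h ≤ a)
    (hab : a ≤ b) (hb : b ≤ h) : ∫ x in a..b, splice h k f γ x = (b - a) * γ := by
  have : ∫ x in a..b, splice h k f γ x = ∫ x in a..b, γ := by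
    rw [intervalIntegral.integral_of_le hab, intervalIntegral.integral_of_le hab,
      integral_Ioc_eq_integral_Ioo, integral_Ioc_eq_integral_Ioo]
    refine setIntegral_congr_fun measurableSet_Ioo fun x hx => ?_
    have hx1 := hx.1
    have hx2 := hx.2
    refine if_neg fun hcon => ?_
    rcases le_or_gt 0 x with h' | h'
    · rw [Int.fract_eq_self.2 ⟨h', by linarith⟩] at hcon
      linarith [hcon.1]
    · have hfr : Int.fract x = x + 1 := by
        rw [← Int.fract_add_one x]
        exact Int.fract_eq_self.2 ⟨by linarith, by linarith⟩
      rw [hfr] at hcon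
      linarith [hcon.2]
  rw [this, intervalIntegral.integral_const, smul_eq_mul]

/-- The map x ↦ kx − kh sends [h, 1 − h] onto [0, N], so whole periods cancel and the primitive from
0 never exceeds C/k. An integral over [a, b] is a difference of two such primitives. -/
theorem abs_integral_splice_le (h0 : 0 < h) (hh : h < 1 / 2) (hk : 0 < k) {N : ℕ}
    (hN : k * (1 - 2 * h) = N) (hf : Measurable f) (hp : Function.Periodic f 1) {C : ℝ}
    (hC : ∀ x, |f x| ≤ C) (hmean : ∫ x in (0 : ℝ)..1, f x = 0) (a b : ℝ) :
    |∫ x in a..b, splice h k f 0 x| ≤ 2 * C / k := by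
  have hC0 : 0 ≤ C := (abs_nonneg _).trans (hC 0)
  have hi := intervalIntegrable_of_measurable_of_abs_le hf hC
  have hsp := splice_periodic h k f 0
  have hsb : ∀ x, |splice h k f 0 x| ≤ C := fun x =>
    splice_mem (s := {y | |y| ≤ C}) hC (by simpa using hC0) x
  have hsi := intervalIntegrable_of_measurable_of_abs_le (measurable_splice h k hf 0) hsb
  have hft : ∀ t, |∫ x in (0 : ℝ)..t, f x| ≤ C := by
    intro t
    rw [hp.intervalIntegral_eq_fract hi hmean]
    refine (intervalIntegral.norm_integral_le_of_norm_le_const (C := C)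
      fun x _ => (Real.norm_eq_abs _).trans_le (hC x)).trans ?_
    rw [sub_zero, abs_of_nonneg (Int.fract_nonneg t)]
    exact mul_le_of_le_one_right hC0 (Int.fract_lt_one t).le
  have hfN : ∫ x in (0 : ℝ)..N, f x = 0 := by
    rw [hp.intervalIntegral_eq_fract hi hmean, Int.fract_natCast, intervalIntegral.integral_same]
  have hmid : ∀ t, h ≤ t → t ≤ 1 - h → ∫ x in (0 : ℝ)..t, splice h k f 0 x =
      k⁻¹ * ∫ x in (0 : ℝ)..(k * t - k * h), f x := by
    intro t ht1 ht2
    rw [← intervalIntegral.integral_add_adjacent_intervals (hsi 0 h) (hsi h t),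
      integral_splice_end hh (by linarith) h0.le le_rfl,
      integral_splice_middle h0 hk le_rfl ht1 ht2]
    simp
  have hfull : ∫ x in (0 : ℝ)..(1 - h), splice h k f 0 x = 0 := by
    rw [hmid _ (by linarith) le_rfl, show k * (1 - h) - k * h = N by linarith, hfN, mul_zero]
  have hlast : ∀ t, 1 - h ≤ t → t ≤ 1 → ∫ x in (0 : ℝ)..t, splice h k f 0 x = 0 := by
    intro t ht1 ht2
    rw [← intervalIntegral.integral_add_adjacent_intervals (hsi 0 (1 - h)) (hsi (1 - h) t), hfull,
      zero_add]
    have := intervalIntegral.integral_comp_add_right (a := -h) (b := t - 1) (splice h k f 0) 1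
    rw [show -h + 1 = 1 - h by ring, show t - 1 + 1 = t by ring] at this
    rw [← this]
    simp only [hsp _]
    rw [integral_splice_end hh le_rfl (by linarith) (by linarith), mul_zero]
  have hprim : ∀ t, |∫ x in (0 : ℝ)..t, splice h k f 0 x| ≤ C / k := by
    intro t
    rw [hsp.intervalIntegral_eq_fract hsi (hlast 1 (by linarith) le_rfl)]
    have ht0 := Int.fract_nonneg t
    have ht1 := (Int.fract_lt_one t).le
    rcases le_total (Int.fract t) h with h1 | h1
    · rw [integral_splice_end hh (by linarith) ht0 h1, mul_zero, abs_zero]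
      positivity
    rcases le_total (Int.fract t) (1 - h) with h2 | h2
    · rw [hmid _ h1 h2, abs_mul, abs_of_pos (inv_pos.2 hk), inv_mul_eq_div]
      exact div_le_div_of_nonneg_right (hft _) hk.le
    · rw [hlast _ h2 ht1, abs_zero]
      positivity
  rw [← intervalIntegral.integral_interval_sub_left (hsi 0 b) (hsi 0 a)]
  refine (abs_sub _ _).trans ?_
  have e : 2 * C / k = C / k + C / k := by ring
  rw [e]
  exact add_le_add (hprim b) (hprim a)

/-- Separates the oscillation of f about its mean P, whose integrals are O(1/k), from a step
function taking the values P and γ. -/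
theorem splice_eq_add (P : ℝ) (x : ℝ) : splice h k f γ x =
    splice h k (fun y => f y - P) 0 x + (γ + (P - γ) * splice h k (fun _ => 1) 0 x) := by
  unfold splice
  split_ifs <;> ring

end Splice

section SpliceMeans

variable {h k : ℝ} {f : ℝ → ℝ} {γ : ℝ}

theorem integral_splice_period (h0 : 0 < h) (hh : h < 1 / 2) (hk : 0 < k) {N : ℕ}
    (hN : k * (1 - 2 * h) = N) (hf : Measurable f) (hp : Function.Periodic f 1) {C : ℝ}
    (hC : ∀ x, |f x| ≤ C) : ∫ x in (0 : ℝ)..1, splice h k f γ x =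
      (1 - 2 * h) * (∫ x in (0 : ℝ)..1, f x) + 2 * h * γ := by
  have hi := intervalIntegrable_of_measurable_of_abs_le hf hC
  have hsb : ∀ x, |splice h k f γ x| ≤ max C |γ| := fun x =>
    splice_mem (s := {y | |y| ≤ max C |γ|}) (fun x => (hC x).trans (le_max_left _ _))
      (le_max_right C |γ|) x
  have hsi := intervalIntegrable_of_measurable_of_abs_le (measurable_splice h k hf γ) hsb
  have h1 := (splice_periodic h k f γ).intervalIntegral_add_eq 0 (-h)
  rw [zero_add] at h1
  have h2 := hp.intervalIntegral_add_zsmul_eq N 0 hi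
  rw [h1, ← intervalIntegral.integral_add_adjacent_intervals (hsi (-h) h) (hsi h _),
    integral_splice_end hh le_rfl (by linarith) le_rfl,
    integral_splice_middle h0 hk le_rfl (by linarith) (by linarith), sub_self,
    show k * (-h + 1) - k * h = 0 + (N : ℤ) • (1 : ℝ) by
      rw [zero_add, zsmul_eq_mul, mul_one, Int.cast_natCast]; linarith, h2, zero_add,
    zsmul_eq_mul, Int.cast_natCast, ← hN]
  field_simp
  ring

theorem abs_integral_splice_sub_le (h0 : 0 < h) (hh : h < 1 / 2) (hk : 0 < k) {N : ℕ}
    (hN : k * (1 - 2 * h) = N) (hf : Measurable f) (hp : Function.Periodic f 1) {P C C' : ℝ}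
    (hC' : ∀ x, |f x| ≤ C') (hC : ∀ x, |f x - P| ≤ C) (hP : ∫ x in (0 : ℝ)..1, f x = P) (a b : ℝ) :
    |(∫ x in a..b, splice h k f γ x) -
      ((b - a) * γ + (P - γ) * ∫ x in a..b, splice h k (fun _ => 1) 0 x)| ≤ 2 * C / k := by
  have hi := intervalIntegrable_of_measurable_of_abs_le hf hC'
  have hmean : ∫ x in (0 : ℝ)..1, (f x - P) = 0 := by
    rw [intervalIntegral.integral_sub (hi 0 1) intervalIntegrable_const, hP]
    simp
  have hper : Function.Periodic (fun x => f x - P) 1 := fun x => by simp only [hp x]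
  have key := abs_integral_splice_le h0 hh hk hN (hf.sub_const P) hper hC hmean a b
  have hE : IntervalIntegrable (splice h k (fun y => f y - P) 0) volume a b :=
    intervalIntegrable_of_measurable_of_abs_le (measurable_splice h k (hf.sub_const P) 0) (C := C)
      (fun x => splice_mem (s := {y | |y| ≤ C}) hC
        (by simpa using (abs_nonneg _).trans (hC 0)) x) a b
  have hχ : IntervalIntegrable (splice h k (fun _ => 1) 0) volume a b :=
    intervalIntegrable_of_measurable_of_abs_le (measurable_splice h k measurable_const 0) (C := 1)
      (fun x => splice_mem (s := {y | |y| ≤ 1}) (by simp) (by simp) x) a b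
  have e : ∫ x in a..b, splice h k f γ x = (∫ x in a..b, splice h k (fun y => f y - P) 0 x) +
      ((b - a) * γ + (P - γ) * ∫ x in a..b, splice h k (fun _ => 1) 0 x) := by
    rw [intervalIntegral.integral_congr (g := fun x => splice h k (fun y => f y - P) 0 x +
      (γ + (P - γ) * splice h k (fun _ => 1) 0 x)) fun x _ => splice_eq_add P x,
      intervalIntegral.integral_add hE (intervalIntegrable_const.add (hχ.const_mul _)),
      intervalIntegral.integral_add intervalIntegrable_const (hχ.const_mul _),
      intervalIntegral.integral_const, intervalIntegral.integral_const_mul, smul_eq_mul]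
  rw [e, add_sub_cancel_right]
  exact key

end SpliceMeans

/-! ### Approximate means and the reverse Jensen inequality. -/

/-- Measurable functions bounded between two positive constants. -/
def IsTwoSidedBounded (v : ℝ → ℝ) : Prop :=
  Measurable v ∧ ∃ c C : ℝ, 0 < c ∧ ∀ x, v x ∈ Icc c C

namespace IsTwoSidedBounded

variable {v : ℝ → ℝ}

theorem pos (hv : IsTwoSidedBounded v) (x : ℝ) : 0 < v x := by
  obtain ⟨-, c, C, hc, h⟩ := hv
  exact hc.trans_le (h x).1

theorem exists_abs_le (hv : IsTwoSidedBounded v) :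
    ∃ K, (∀ x, |v x| ≤ K) ∧ (∀ x, |Real.log (v x)| ≤ K) := by
  obtain ⟨-, c, C, hc, h⟩ := hv
  refine ⟨|C| + |Real.log c| + |Real.log C|, fun x => ?_, fun x => ?_⟩
  · rw [abs_of_pos (hc.trans_le (h x).1)]
    linarith [(h x).2, le_abs_self C, abs_nonneg (Real.log c), abs_nonneg (Real.log C)]
  · have h1 := Real.log_le_log hc (h x).1
    have h2 := Real.log_le_log (hc.trans_le (h x).1) (h x).2
    rw [abs_le]
    constructor
    · linarith [neg_abs_le (Real.log c), abs_nonneg C, abs_nonneg (Real.log C)]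
    · linarith [le_abs_self (Real.log C), abs_nonneg C, abs_nonneg (Real.log c)]

theorem intervalIntegrable (hv : IsTwoSidedBounded v) (a b : ℝ) :
    IntervalIntegrable v volume a b := by
  obtain ⟨K, hK, -⟩ := hv.exists_abs_le
  exact intervalIntegrable_of_measurable_of_abs_le hv.1 hK a b

theorem intervalIntegrable_log (hv : IsTwoSidedBounded v) (a b : ℝ) :
    IntervalIntegrable (fun x => Real.log (v x)) volume a b := by
  obtain ⟨K, -, hK⟩ := hv.exists_abs_le
  exact intervalIntegrable_of_measurable_of_abs_le hv.1.log hK a b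

theorem splice (hv : IsTwoSidedBounded v) (h k : ℝ) {γ : ℝ} (hγ : 0 < γ) :
    IsTwoSidedBounded (splice h k v γ) := by
  obtain ⟨hm, c, C, hc, hb⟩ := hv
  refine ⟨measurable_splice h k hm γ, min c γ, max C γ, lt_min hc hγ, splice_mem (fun x => ?_) ?_⟩
  · exact ⟨(min_le_left _ _).trans (hb x).1, (hb x).2.trans (le_max_left _ _)⟩
  · exact ⟨min_le_right _ _, le_max_right _ _⟩

end IsTwoSidedBounded

/-- The means of `v` and `log v` over `[a, b]` are at most `X + ε` and at least `Y - ε`. -/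
structure NearMeans (ε : ℝ) (v : ℝ → ℝ) (a b X Y : ℝ) : Prop where
  upper : ∫ x in a..b, v x ≤ (b - a) * (X + ε)
  lower : (b - a) * (Y - ε) ≤ ∫ x in a..b, Real.log (v x)

/-- The `A_∞` condition with constant `exp q` on a single interval. -/
def ReverseJensen (q : ℝ) (v : ℝ → ℝ) (a b : ℝ) : Prop :=
  ∫ x in a..b, v x ≤ (b - a) * Real.exp (q + (∫ x in a..b, Real.log (v x)) / (b - a))

theorem NearMeans.mono {ε ε' : ℝ} {v : ℝ → ℝ} {a b X Y : ℝ} (h : NearMeans ε v a b X Y)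
    (hab : a ≤ b) (hε : ε ≤ ε') : NearMeans ε' v a b X Y :=
  ⟨h.upper.trans (mul_le_mul_of_nonneg_left (by linarith) (by linarith)),
    (mul_le_mul_of_nonneg_left (by linarith) (by linarith)).trans h.lower⟩

/-- The lower bound m on X turns the additive error into a factor: X + ε ≤ X exp(ε/m). The gap
between q₀ and q pays for this and for the error in the logarithmic mean. -/
theorem NearMeans.reverseJensen {ε q q₀ m : ℝ} {v : ℝ → ℝ} {a b X Y : ℝ}
    (h : NearMeans ε v a b X Y) (hab : a < b) (hε : 0 ≤ ε) (hm : 0 < m) (hmX : m ≤ X)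
    (hXY : X ≤ Real.exp (q₀ + Y)) (hq : q₀ + ε / m + ε ≤ q) : ReverseJensen q v a b := by
  have hba : 0 < b - a := sub_pos.2 hab
  refine h.upper.trans (mul_le_mul_of_nonneg_left ?_ hba.le)
  have hX : 0 < X := hm.trans_le hmX
  have h1 : X + ε ≤ X * (1 + ε / m) := by
    have : ε ≤ X * (ε / m) := by
      rw [← mul_div_assoc, le_div_iff₀ hm, mul_comm]
      exact mul_le_mul_of_nonneg_right hmX hε
    linarith
  have h2 : 1 + ε / m ≤ Real.exp (ε / m) := by linarith [Real.add_one_le_exp (ε / m)]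
  have h3 : Y - ε ≤ (∫ x in a..b, Real.log (v x)) / (b - a) := by
    rw [le_div_iff₀ hba, mul_comm]
    exact h.lower
  calc X + ε ≤ X * (1 + ε / m) := h1
    _ ≤ Real.exp (q₀ + Y) * Real.exp (ε / m) :=
        mul_le_mul hXY h2 (by positivity) (Real.exp_pos _).le
    _ = Real.exp (q₀ + Y + ε / m) := (Real.exp_add _ _).symm
    _ ≤ _ := Real.exp_le_exp.2 (by linarith)

/-- Means over a union are convex combinations of the means over its parts, so the error does not
accumulate. -/
theorem NearMeans.append {ε : ℝ} {v : ℝ → ℝ} (hv : IsTwoSidedBounded v) {a b c X Y X' Y' : ℝ}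
    (h : NearMeans ε v a b X Y) (h' : NearMeans ε v b c X' Y') (hac : a < c) :
    NearMeans ε v a c ((b - a) / (c - a) * X + (c - b) / (c - a) * X')
      ((b - a) / (c - a) * Y + (c - b) / (c - a) * Y') := by
  have hca : 0 < c - a := sub_pos.2 hac
  constructor
  · rw [← intervalIntegral.integral_add_adjacent_intervals (hv.intervalIntegrable a b)
      (hv.intervalIntegrable b c)]
    refine (add_le_add h.upper h'.upper).trans (le_of_eq ?_)
    field_simp
    ring
  · rw [← intervalIntegral.integral_add_adjacent_intervals (hv.intervalIntegrable_log a b)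
      (hv.intervalIntegrable_log b c)]
    refine le_trans (le_of_eq ?_) (add_le_add h.lower h'.lower)
    field_simp
    ring

theorem log_splice (h k : ℝ) (v : ℝ → ℝ) (γ : ℝ) :
    (fun x => Real.log (splice h k v γ x)) = splice h k (fun x => Real.log (v x)) (Real.log γ) :=
  funext (comp_splice Real.log h k v γ)

section SpliceNear

variable {h k γ ε : ℝ} {v : ℝ → ℝ}

theorem nearMeans_splice_end (hh : h < 1 / 2) (hε : 0 ≤ ε) {a b : ℝ} (ha : -h ≤ a)
    (hab : a ≤ b) (hb : b ≤ h) : NearMeans ε (splice h k v γ) a b γ (Real.log γ) := by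
  have hba : 0 ≤ b - a := sub_nonneg.2 hab
  constructor
  · rw [integral_splice_end hh ha hab hb]
    exact mul_le_mul_of_nonneg_left (by linarith) hba
  · rw [log_splice, integral_splice_end hh ha hab hb]
    exact mul_le_mul_of_nonneg_left (by linarith) hba

theorem nearMeans_shift {v : ℝ → ℝ} (hp : Function.Periodic v 1) (n : ℤ) {a b X Y : ℝ}
    (hv : NearMeans ε v (a - n) (b - n) X Y) : NearMeans ε v a b X Y := by
  have hpn : ∀ x, v (x - n) = v x := fun x => by
    simpa using hp.sub_int_mul_eq (x := x) n
  have h1 := hv.upper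
  have h2 := hv.lower
  rw [← intervalIntegral.integral_comp_sub_right] at h1
  rw [← intervalIntegral.integral_comp_sub_right (fun x => Real.log (v x))] at h2
  simp only [hpn] at h1 h2
  exact ⟨by convert h1 using 2; ring, by convert h2 using 2; ring⟩

theorem nearMeans_splice_middle (h0 : 0 < h) (hk : 0 < k) {a b X Y : ℝ} (ha : h ≤ a) (hab : a ≤ b)
    (hb : b ≤ 1 - h) (hv : NearMeans ε v (k * a - k * h) (k * b - k * h) X Y) :
    NearMeans ε (splice h k v γ) a b X Y := by
  have e : ∀ Z, (b - a) * Z = k⁻¹ * ((k * b - k * h - (k * a - k * h)) * Z) := fun Z => by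
    field_simp
    ring
  constructor
  · rw [integral_splice_middle h0 hk ha hab hb, e]
    exact mul_le_mul_of_nonneg_left hv.upper (inv_pos.2 hk).le
  · rw [log_splice, integral_splice_middle h0 hk ha hab hb, e]
    exact mul_le_mul_of_nonneg_left hv.lower (inv_pos.2 hk).le

theorem reverseJensen_splice_middle {q : ℝ} (h0 : 0 < h) (hk : 0 < k) {a b : ℝ} (ha : h ≤ a)
    (hab : a < b) (hb : b ≤ 1 - h) (hv : ReverseJensen q v (k * a - k * h) (k * b - k * h)) :
    ReverseJensen q (splice h k v γ) a b := by
  have hba : 0 < b - a := sub_pos.2 hab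
  unfold ReverseJensen at hv ⊢
  rw [log_splice, integral_splice_middle h0 hk ha hab.le hb,
    integral_splice_middle h0 hk ha hab.le hb]
  refine (mul_le_mul_of_nonneg_left hv (inv_pos.2 hk).le).trans (le_of_eq ?_)
  have e1 : k * b - k * h - (k * a - k * h) = k * (b - a) := by ring
  rw [e1, ← mul_assoc, inv_mul_cancel_left₀ hk.ne', div_mul_eq_div_div_swap]
  congr 3
  field_simp

theorem reverseJensen_shift {q : ℝ} {v : ℝ → ℝ} (hp : Function.Periodic v 1) (n : ℤ) {a b : ℝ}
    (hv : ReverseJensen q v (a - n) (b - n)) : ReverseJensen q v a b := by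
  have hpn : ∀ x, v (x - n) = v x := fun x => by
    simpa using hp.sub_int_mul_eq (x := x) n
  unfold ReverseJensen at hv ⊢
  rw [← intervalIntegral.integral_comp_sub_right,
    ← intervalIntegral.integral_comp_sub_right (fun x => Real.log (v x))] at hv
  simp only [hpn, sub_sub_sub_cancel_right] at hv
  exact hv

end SpliceNear

/-! ### The cascade of weights. -/

/-- Periodic weights all of whose `A_∞` quantities are at most `exp q`, with prescribed means, and
whose means over intervals starting or ending at `0` are `ε`-close to the segment from `(p₁, p₂)`
to `(g, log g)`. -/
structure IsCascade (q p₁ p₂ g P₁ P₂ P₃ ε : ℝ) (v : ℝ → ℝ) : Prop where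
  bounded : IsTwoSidedBounded v
  periodic : Function.Periodic v 1
  reverseJensen : ∀ a b, a < b → ReverseJensen q v a b
  right : ∀ r, 0 < r → ∃ s ∈ Icc (0 : ℝ) 1,
    NearMeans ε v 0 r (s * p₁ + (1 - s) * g) (s * p₂ + (1 - s) * Real.log g)
  left : ∀ r, 0 < r → ∃ s ∈ Icc (0 : ℝ) 1,
    NearMeans ε v (-r) 0 (s * p₁ + (1 - s) * g) (s * p₂ + (1 - s) * Real.log g)
  mean : ∫ x in (0 : ℝ)..1, v x = P₁
  mean_log : ∫ x in (0 : ℝ)..1, Real.log (v x) = P₂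
  mean_mul_log : ∫ x in (0 : ℝ)..1, v x * Real.log (v x) = P₃

theorem IsTwoSidedBounded.exists_abs_mul_log_le {v : ℝ → ℝ} (hv : IsTwoSidedBounded v) :
    ∃ K, ∀ x, |v x * Real.log (v x)| ≤ K := by
  obtain ⟨K, h1, h2⟩ := hv.exists_abs_le
  refine ⟨K * K, fun x => ?_⟩
  rw [abs_mul]
  exact mul_le_mul (h1 x) (h2 x) (abs_nonneg _) ((abs_nonneg _).trans (h1 x))

theorem integral_splice_indicator_mem {h k a b : ℝ} (hab : a ≤ b) :
    ∫ x in a..b, splice h k (fun _ => 1) 0 x ∈ Icc 0 (b - a) := by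
  have hmem : ∀ x, splice h k (fun _ => (1 : ℝ)) 0 x ∈ Icc (0 : ℝ) 1 :=
    splice_mem (by simp) (by simp)
  have hi : IntervalIntegrable (splice h k (fun _ => 1) 0) volume a b :=
    intervalIntegrable_of_measurable_of_abs_le (measurable_splice h k measurable_const 0) (C := 1)
      (fun x => abs_le.2 ⟨by linarith [(hmem x).1], (hmem x).2⟩) a b
  refine ⟨intervalIntegral.integral_nonneg hab fun x _ => (hmem x).1, ?_⟩
  have := intervalIntegral.integral_mono_on hab hi intervalIntegrable_const fun x _ => (hmem x).2
  simpa using this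

/-- The parameter s is the fraction of [a, b] occupied by rescaled copies of v. On an interval of
length at least ℓ the oscillation error 2K/k is negligible. -/
theorem nearMeans_splice {h k γ ε K P₁ P₂ ℓ : ℝ} {v : ℝ → ℝ} (h0 : 0 < h) (hh : h < 1 / 2)
    (hk : 0 < k) {N : ℕ} (hN : k * (1 - 2 * h) = N) (hv : IsTwoSidedBounded v)
    (hp : Function.Periodic v 1) (hP₁ : ∫ x in (0 : ℝ)..1, v x = P₁)
    (hP₂ : ∫ x in (0 : ℝ)..1, Real.log (v x) = P₂) (hK₁ : ∀ x, |v x - P₁| ≤ K)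
    (hK₂ : ∀ x, |Real.log (v x) - P₂| ≤ K) (hε : 0 ≤ ε) (hℓ : 0 < ℓ) (hkK : 2 * K / k ≤ ε * ℓ)
    {a b : ℝ} (hab : ℓ ≤ b - a) :
    ∃ s ∈ Icc (0 : ℝ) 1, NearMeans ε (splice h k v γ) a b (s * P₁ + (1 - s) * γ)
      (s * P₂ + (1 - s) * Real.log γ) := by
  obtain ⟨K', hK', hK''⟩ := hv.exists_abs_le
  have hba : 0 < b - a := hℓ.trans_le hab
  have hχ := integral_splice_indicator_mem (h := h) (k := k) (sub_pos.1 hba).le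
  set σ := ∫ x in a..b, splice h k (fun _ => 1) 0 x with hσ
  have hplog : Function.Periodic (fun x => Real.log (v x)) 1 := fun x => by simp only [hp x]
  have e1 := abs_le.1 (abs_integral_splice_sub_le (γ := γ) h0 hh hk hN hv.1 hp hK' hK₁ hP₁ a b)
  have e2 := abs_le.1 (abs_integral_splice_sub_le (γ := Real.log γ) h0 hh hk hN hv.1.log hplog
    hK'' hK₂ hP₂ a b)
  have herr : 2 * K / k ≤ (b - a) * ε :=
    hkK.trans (by rw [mul_comm]; exact mul_le_mul_of_nonneg_right hab hε)
  refine ⟨σ / (b - a), ⟨div_nonneg hχ.1 hba.le, (div_le_one hba).2 hχ.2⟩, ?_, ?_⟩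
  · have e : (b - a) * (σ / (b - a) * P₁ + (1 - σ / (b - a)) * γ + ε) =
        (b - a) * γ + (P₁ - γ) * σ + (b - a) * ε := by
      field_simp
      ring
    rw [e]
    linarith [e1.2]
  · have e : (b - a) * (σ / (b - a) * P₂ + (1 - σ / (b - a)) * Real.log γ - ε) =
        (b - a) * Real.log γ + (P₂ - Real.log γ) * σ - (b - a) * ε := by
      field_simp
      ring
    rw [e, log_splice]
    linarith [e2.1]

/-- Put g' on a fraction θ of each period and fast copies of v on the rest. Apart from intervals
inside one copy, where v's own inequality applies, every interval has means near the triangle with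
vertices (p₁, p₂), (g, log g), (g', log g'), which `hT` places in the allowed region. Intervals
crossing a junction see v only from one of its integer points, which is why `IsCascade` records the
means of intervals starting or ending at 0. -/
theorem exists_isCascade_step {q q₀ p₁ p₂ g g' P₁ P₂ P₃ θ s₀ : ℝ} (hq : q₀ < q) (hp₁ : 0 < p₁)
    (hg : 0 < g) (hg' : 0 < g')
    (hT : ∀ s t r : ℝ, 0 ≤ s → 0 ≤ t → 0 ≤ r → s + t + r = 1 →
      s * p₁ + t * g + r * g' ≤ Real.exp (q₀ + (s * p₂ + t * Real.log g + r * Real.log g')))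
    (hs₀ : s₀ ∈ Icc (0 : ℝ) 1) (hP₁ : P₁ = s₀ * p₁ + (1 - s₀) * g)
    (hP₂ : P₂ = s₀ * p₂ + (1 - s₀) * Real.log g) (hθ : θ ∈ Ioo (0 : ℝ) 1)
    (hex : ∀ ε, 0 < ε → ∃ v, IsCascade q p₁ p₂ g P₁ P₂ P₃ ε v) {ε : ℝ} (hε : 0 < ε) :
    ∃ v, IsCascade q P₁ P₂ g' ((1 - θ) * P₁ + θ * g') ((1 - θ) * P₂ + θ * Real.log g')
      ((1 - θ) * P₃ + θ * (g' * Real.log g')) ε v := by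
  obtain ⟨hθ0, hθ1⟩ := hθ
  obtain ⟨m, hm, hmp, hmg, hmg'⟩ : ∃ m, 0 < m ∧ m ≤ p₁ ∧ m ≤ g ∧ m ≤ g' :=
    ⟨min p₁ (min g g'), by positivity, min_le_left _ _,
      (min_le_right _ _).trans (min_le_left _ _), (min_le_right _ _).trans (min_le_right _ _)⟩
  -- The slack q − q₀ fixes the accuracy demanded of the previous weight before k is chosen.
  obtain ⟨ε₀, hε₀, hε₀q⟩ : ∃ ε₀, 0 < ε₀ ∧ q₀ + ε₀ / m + ε₀ ≤ q := by
    refine ⟨(q - q₀) / (1 / m + 1), div_pos (sub_pos.2 hq) (by positivity), le_of_eq ?_⟩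
    field_simp
    ring
  obtain ⟨v, hv⟩ := hex ε₀ hε₀
  set h := θ / 2 with hh
  have h0 : 0 < h := by positivity
  have hh2 : h < 1 / 2 := by linarith
  have hθh : θ = 2 * h := by linarith
  obtain ⟨K', hK', hK''⟩ := hv.bounded.exists_abs_le
  obtain ⟨K, hK0, hK₁, hK₂⟩ : ∃ K, 0 < K ∧ (∀ x, |v x - P₁| ≤ K) ∧
      (∀ x, |Real.log (v x) - P₂| ≤ K) := by
    have hK0' : 0 ≤ K' := (abs_nonneg _).trans (hK' 0)
    refine ⟨K' + |P₁| + |P₂| + 1, by positivity, fun x => ?_, fun x => ?_⟩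
    · linarith [abs_sub (v x) P₁, hK' x, abs_nonneg P₂]
    · linarith [abs_sub (Real.log (v x)) P₂, hK'' x, abs_nonneg P₁]
  obtain ⟨ℓ, hℓ, hℓh, hℓh'⟩ : ∃ ℓ, 0 < ℓ ∧ ℓ ≤ h ∧ ℓ ≤ 1 - 2 * h :=
    ⟨min h (1 - 2 * h), lt_min h0 (by linarith), min_le_left _ _, min_le_right _ _⟩
  obtain ⟨ε₁, hε₁, hε₁₀, hε₁ε⟩ : ∃ ε₁, 0 < ε₁ ∧ ε₁ ≤ ε₀ ∧ ε₁ ≤ ε :=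
    ⟨min ε₀ ε, lt_min hε₀ hε, min_le_left _ _, min_le_right _ _⟩
  obtain ⟨N, hNlarge⟩ := exists_nat_ge (2 * K / (ε₁ * ℓ))
  have hN0 : (0 : ℝ) < N := lt_of_lt_of_le (by positivity) hNlarge
  have hc : 0 < 1 - 2 * h := by linarith
  obtain ⟨k, hk, hkN, hkK⟩ : ∃ k, 0 < k ∧ k * (1 - 2 * h) = N ∧ 2 * K / k ≤ ε₁ * ℓ := by
    refine ⟨N / (1 - 2 * h), by positivity, by field_simp, ?_⟩
    have h1 : 2 * K / (ε₁ * ℓ) ≤ N / (1 - 2 * h) := by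
      refine hNlarge.trans ?_
      rw [le_div_iff₀ hc]
      nlinarith
    rw [div_le_iff₀ (by positivity)] at h1 ⊢
    linarith
  set V := splice h k v g' with hV
  have hVper : Function.Periodic V 1 := splice_periodic h k v g'
  have hVb : IsTwoSidedBounded V := hv.bounded.splice h k hg'
  have hnear : ∀ a b, ℓ ≤ b - a → ∃ s ∈ Icc (0 : ℝ) 1,
      NearMeans ε₁ V a b (s * P₁ + (1 - s) * g') (s * P₂ + (1 - s) * Real.log g') :=
    fun a b hab => nearMeans_splice h0 hh2 hk hkN hv.bounded hv.periodic hv.mean hv.mean_log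
      hK₁ hK₂ hε₁.le hℓ hkK hab
  have htri : ∀ s t r a b X Y, a < b → 0 ≤ s → 0 ≤ t → 0 ≤ r → s + t + r = 1 →
      X = s * p₁ + t * g + r * g' → Y = s * p₂ + t * Real.log g + r * Real.log g' →
      NearMeans ε₀ V a b X Y → ReverseJensen q V a b := by
    intro s t r a b X Y hab hs ht hr hsum hX hY hn
    refine hn.reverseJensen (q₀ := q₀) hab hε₀.le hm ?_ ?_ hε₀q
    · have : m = s * m + t * m + r * m := by rw [← add_mul, ← add_mul, hsum, one_mul]
      rw [hX, this]
      gcongr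
    · rw [hX, hY]
      exact hT s t r hs ht hr hsum
  -- Long intervals have means near the segment from P to g', and P itself lies on the segment from
  -- p to g.
  have hlong : ∀ a b, ℓ ≤ b - a → ReverseJensen q V a b := by
    intro a b hab
    obtain ⟨s, hs, hn⟩ := hnear a b hab
    have hab' : a < b := by linarith
    refine htri (s * s₀) (s * (1 - s₀)) (1 - s) a b _ _ hab' (mul_nonneg hs.1 hs₀.1)
      (mul_nonneg hs.1 (sub_nonneg.2 hs₀.2)) (sub_nonneg.2 hs.2) (by ring) ?_ ?_
      (hn.mono hab'.le hε₁₀)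
    · rw [hP₁]; ring
    · rw [hP₂]; ring
  -- Since ℓ ≤ h and ℓ ≤ 1 − 2h, a short interval crosses at most one of the junctions h and 1 − h.
  have hshort : ∀ a b, a < b → b - a < ℓ → -h ≤ a → a < 1 - h → ReverseJensen q V a b := by
    intro a b hab hbl ha ha'
    have hba : 0 < b - a := sub_pos.2 hab
    rcases lt_or_ge a h with h1 | h1
    · rcases le_or_gt b h with h2 | h2
      · exact htri 0 0 1 a b _ _ hab le_rfl le_rfl zero_le_one (by ring) (by ring) (by ring)
          (nearMeans_splice_end hh2 hε₀.le ha hab.le h2)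
      · obtain ⟨s, hs, hn⟩ := hv.right (k * b - k * h) (by nlinarith)
        have hn1 := nearMeans_splice_end (k := k) (v := v) (γ := g') hh2 hε₀.le ha h1.le le_rfl
        have hn2 := nearMeans_splice_middle (γ := g') h0 hk le_rfl h2.le (b := b) (by linarith)
          (by rwa [sub_self])
        have hn3 := hn1.append hVb hn2 hab
        have hτ : 0 ≤ (b - h) / (b - a) := div_nonneg (by linarith) hba.le
        refine htri ((b - h) / (b - a) * s) ((b - h) / (b - a) * (1 - s)) ((h - a) / (b - a)) a b
          _ _ hab (mul_nonneg hτ hs.1) (mul_nonneg hτ (sub_nonneg.2 hs.2))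
          (div_nonneg (by linarith) hba.le) ?_ ?_ ?_ hn3
        · field_simp; ring
        · ring
        · ring
    · rcases le_or_gt b (1 - h) with h2 | h2
      · exact reverseJensen_splice_middle h0 hk h1 hab h2
          (hv.reverseJensen _ _ (by nlinarith))
      · obtain ⟨s, hs, hn⟩ := hv.left (N - (k * a - k * h)) (by nlinarith)
        have hn1 := nearMeans_splice_middle (γ := g') h0 hk h1 ha'.le le_rfl
          (nearMeans_shift hv.periodic N (a := k * a - k * h) (b := k * (1 - h) - k * h) (by
            rw [Int.cast_natCast, show k * (1 - h) - k * h - N = 0 by linarith,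
              ← neg_sub]
            exact hn))
        have hn2 : NearMeans ε₀ V (1 - h) b g' (Real.log g') :=
          nearMeans_shift hVper 1 (nearMeans_splice_end hh2 hε₀.le
            (by push_cast; linarith) (by push_cast; linarith) (by push_cast; linarith))
        have hn3 := hn1.append hVb hn2 hab
        have hτ : 0 ≤ (1 - h - a) / (b - a) := div_nonneg (by linarith) hba.le
        refine htri ((1 - h - a) / (b - a) * s) ((1 - h - a) / (b - a) * (1 - s))
          ((b - (1 - h)) / (b - a)) a b _ _ hab (mul_nonneg hτ hs.1)
          (mul_nonneg hτ (sub_nonneg.2 hs.2)) (div_nonneg (by linarith) hba.le) ?_ ?_ ?_ hn3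
        · field_simp; ring
        · ring
        · ring
  refine ⟨V, hVb, hVper, fun a b hab => ?_, fun r hr => ?_, fun r hr => ?_, ?_, ?_, ?_⟩
  · rcases le_or_gt ℓ (b - a) with h1 | h1
    · exact hlong a b h1
    -- This translation brings the left endpoint into [−h, 1 − h).
    · refine reverseJensen_shift hVper ⌊a + h⌋ (hshort _ _ (by linarith) (by linarith) ?_ ?_)
      · linarith [Int.floor_le (a + h)]
      · linarith [Int.lt_floor_add_one (a + h)]
  · rcases le_or_gt r h with h1 | h1
    · refine ⟨0, by simp, ?_⟩
      simpa using nearMeans_splice_end (k := k) (v := v) (γ := g') hh2 hε.le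
        (by linarith : -h ≤ 0) hr.le h1
    · obtain ⟨s, hs, hn⟩ := hnear 0 r (by linarith)
      exact ⟨s, hs, hn.mono hr.le hε₁ε⟩
  · rcases le_or_gt r h with h1 | h1
    · refine ⟨0, by simp, ?_⟩
      simpa using nearMeans_splice_end (k := k) (v := v) (γ := g') hh2 hε.le
        (by linarith : -h ≤ -r) (by linarith) h0.le
    · obtain ⟨s, hs, hn⟩ := hnear (-r) 0 (by linarith)
      exact ⟨s, hs, hn.mono (by linarith) hε₁ε⟩
  · rw [integral_splice_period h0 hh2 hk hkN hv.bounded.1 hv.periodic hK', hv.mean, hθh]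
  · rw [hV, log_splice, integral_splice_period h0 hh2 hk hkN hv.bounded.1.log
      (fun x => by simp only [hv.periodic x]) hK'', hv.mean_log, hθh]
  · obtain ⟨K₃, hK₃⟩ := hv.bounded.exists_abs_mul_log_le
    have e : (fun x => V x * Real.log (V x)) =
        splice h k (fun x => v x * Real.log (v x)) (g' * Real.log g') :=
      funext (comp_splice (fun y => y * Real.log y) h k v g')
    rw [e, integral_splice_period (f := fun x => v x * Real.log (v x)) h0 hh2 hk hkN (hv.bounded.1.mul hv.bounded.1.log)
      (fun x => by simp only [hv.periodic x]) hK₃, hv.mean_mul_log, hθh]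

/-- Write D₀ = γ − 1 − log γ. The tangent at X = 1 to the boundary curve Y = log X − D₀ has slope 1
and meets Y = log X at X = γ, so by concavity of log the segment from (1, −D₀) to (γ, log γ) stays
in the allowed region. The extra −log M makes room for the third vertex. -/
theorem triangle_le_exp {γ M D s t r : ℝ} (hγ : 0 < γ) (hM0 : 0 < M) (hM1 : M ≤ 1)
    (hD : D ≤ γ - 1 - Real.log γ) (hs : 0 ≤ s) (ht : 0 ≤ t) (hr : 0 ≤ r) (hsum : s + t + r = 1) :
    s + t * γ + r * (γ * M) ≤ Real.exp (γ - 1 - Real.log γ - Real.log M +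
      (-(s * D) + t * Real.log γ + r * (Real.log γ + Real.log M))) := by
  have hlM : Real.log M ≤ 0 := Real.log_nonpos hM0.le hM1
  have h1 : s + t * γ + r * (γ * M) ≤ (t + r) * (γ - 1) + 1 := by
    have : r * (γ * M) ≤ r * γ := mul_le_mul_of_nonneg_left (mul_le_of_le_one_right hγ.le hM1) hr
    have hs' : s = 1 - t - r := by linarith
    rw [hs']
    linarith
  refine h1.trans ((Real.add_one_le_exp _).trans (Real.exp_le_exp.2 ?_))
  have h2 : s * D ≤ s * (γ - 1 - Real.log γ) := mul_le_mul_of_nonneg_left hD hs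
  have h3 : 0 ≤ (s + t) * -Real.log M := mul_nonneg (by linarith) (by linarith)
  have hr' : r = 1 - s - t := by linarith
  subst hr'
  linarith

theorem isCascade_one {q ε : ℝ} (hq : 0 ≤ q) (hε : 0 ≤ ε) :
    IsCascade q 1 0 1 1 0 0 ε (fun _ => 1) := by
  refine ⟨⟨measurable_const, 1, 1, one_pos, by simp⟩, fun _ => rfl, fun a b hab => ?_,
    fun r hr => ⟨1, by simp, ?_, ?_⟩, fun r hr => ⟨1, by simp, ?_, ?_⟩, by simp, by simp, by simp⟩
  · have : 0 < b - a := sub_pos.2 hab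
    simp only [ReverseJensen, intervalIntegral.integral_const, smul_eq_mul, Real.log_one, mul_one,
      mul_zero, zero_div, add_zero]
    exact le_mul_of_one_le_right this.le (Real.one_le_exp hq)
  all_goals simp; nlinarith

/-- Here x and y are the current and previous means, g is the last constant spliced in, and D, Dy
are the gaps log(mean) − mean(log). Each step splices in γx and multiplies the mean by M. The
invariant D ≤ γ − 1 − log γ keeps the next triangle admissible, whatever the number of steps. -/
theorem exists_isCascade {γ θ M q : ℝ} (hγ0 : 0 < γ) (hγ1 : γ < 1) (hθ : θ ∈ Ioo (0 : ℝ) 1)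
    (hM : M = 1 - θ + θ * γ) (hq : γ - 1 - Real.log γ - Real.log M < q) (n : ℕ) :
    ∃ y Dy g x D s : ℝ, 0 < y ∧ 0 < g ∧ 0 < x ∧ D ≤ γ - 1 - Real.log γ ∧ s ∈ Icc (0 : ℝ) 1 ∧
      x = s * y + (1 - s) * g ∧
      Real.log x - D = s * (Real.log y - Dy) + (1 - s) * Real.log g ∧
      (∀ s t r : ℝ, 0 ≤ s → 0 ≤ t → 0 ≤ r → s + t + r = 1 → s * y + t * g + r * (γ * x) ≤
        Real.exp (γ - 1 - Real.log γ - Real.log M + (s * (Real.log y - Dy) + t * Real.log g +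
          r * Real.log (γ * x)))) ∧
      ∀ ε, 0 < ε → ∃ v, IsCascade q y (Real.log y - Dy) g x (Real.log x - D)
        (x * ((Real.log γ - M * Real.log M / (θ * γ)) * (1 - ((1 - θ) / M) ^ n) + Real.log x))
        ε v := by
  obtain ⟨hθ0, hθ1⟩ := hθ
  have hM0 : 0 < M := by rw [hM]; nlinarith
  have hM1 : M ≤ 1 := by rw [hM]; nlinarith
  have hlM : Real.log M ≤ M - 1 := Real.log_le_sub_one_of_pos hM0
  have hlM0 : Real.log M ≤ 0 := Real.log_nonpos hM0.le hM1
  have hD0 : 0 ≤ γ - 1 - Real.log γ := by linarith [Real.log_le_sub_one_of_pos hγ0]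
  induction n with
  | zero =>
    refine ⟨1, 0, 1, 1, 0, 1, one_pos, one_pos, one_pos, hD0, by simp, by simp, by simp, ?_, ?_⟩
    · intro s t r hs ht hr hsum
      have := triangle_le_exp hγ0 hM0 hM1 hD0 (add_nonneg hs ht) hr le_rfl
        (by rw [add_zero, hsum])
      simpa using this
    · intro ε hε
      refine ⟨fun _ => 1, ?_⟩
      simpa using isCascade_one (q := q) (by linarith) hε.le
  | succ n ih =>
    obtain ⟨y, Dy, g, x, D, s, hy, hg, hx, hD, hs, hxe, hDe, hT, hex⟩ := ih
    have hlx : ∀ z, 0 < z → Real.log (z * x) = Real.log z + Real.log x := fun z hz =>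
      Real.log_mul hz.ne' hx.ne'
    have hlγM : Real.log (γ * (M * x)) = Real.log γ + Real.log M + Real.log x := by
      rw [← mul_assoc, hlx _ (by positivity), Real.log_mul hγ0.ne' hM0.ne']
    -- The new gap is log(Mx) minus the new logarithmic mean (1 − θ)(log x − D) + θ log(γx). As log
    -- M ≤ θ(γ − 1), it is at most a convex combination of D and γ − 1 − log γ.
    refine ⟨x, D, γ * x, M * x, (1 - θ) * D + Real.log M - θ * Real.log γ, 1 - θ, hx, by positivity,
      by positivity, ?_, ⟨by linarith, by linarith⟩, ?_, ?_, ?_, ?_⟩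
    · have : (1 - θ) * D ≤ (1 - θ) * (γ - 1 - Real.log γ) :=
        mul_le_mul_of_nonneg_left hD (by linarith)
      rw [hM] at hlM ⊢
      linarith
    · rw [hM]; ring
    · rw [hlx M hM0, hlx γ hγ0]; ring
    · intro s t r hs ht hr hsum
      have := mul_le_mul_of_nonneg_right (triangle_le_exp hγ0 hM0 hM1 hD hs ht hr hsum) hx.le
      nth_rewrite 2 [← Real.exp_log hx] at this
      rw [← Real.exp_add] at this
      refine (le_of_eq ?_).trans (this.trans (le_of_eq ?_))
      · ring
      · rw [hlγM, hlx γ hγ0]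
        have hr' : r = 1 - s - t := by linarith
        subst hr'
        ring_nf
    · intro ε hε
      obtain ⟨v, hv⟩ := exists_isCascade_step hq hy hg (mul_pos hγ0 hx) hT hs hxe hDe ⟨hθ0, hθ1⟩
        hex hε
      refine ⟨v, ?_⟩
      convert hv using 1
      · rw [hM]; ring
      · rw [hlx M hM0, hlx γ hγ0]; ring
      · rw [hlx M hM0, hlx γ hγ0]
        -- The normalized entropies satisfy M E_{n+1} = (1 − θ) E_n + θγ log γ − M log M with E_0 =
        -- 0. Because M − (1 − θ) = θγ, the fixed point is log γ − M log M/(θγ), approached at the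
        -- rate (1 − θ)/M.
        have hE : M * ((Real.log γ - M * Real.log M / (θ * γ)) * (1 - ((1 - θ) / M) ^ (n + 1))) =
            (1 - θ) * ((Real.log γ - M * Real.log M / (θ * γ)) * (1 - ((1 - θ) / M) ^ n)) +
              θ * γ * Real.log γ - M * Real.log M := by
          have e1 : M * ((1 - θ) / M) ^ (n + 1) = (1 - θ) * ((1 - θ) / M) ^ n := by
            rw [pow_succ]
            field_simp
          have e2 : θ * γ * (Real.log γ - M * Real.log M / (θ * γ)) =
              θ * γ * Real.log γ - M * Real.log M := by
            field_simp
          have e3 : θ * γ = M - (1 - θ) := by rw [hM]; ring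
          rw [add_sub_assoc, ← e2, e3]
          linear_combination (-(Real.log γ - M * Real.log M / (M - (1 - θ)))) * e1
        rw [hM] at hE ⊢
        linear_combination x * hE

/-! ### Sharpness of the constant e. -/

theorem IsTwoSidedBounded.isWeight {v : ℝ → ℝ} (hv : IsTwoSidedBounded v) : IsWeight v := by
  obtain ⟨K, hK, -⟩ := hv.exists_abs_le
  refine ⟨?_, ae_of_all _ hv.pos⟩
  exact ((memLp_top_of_bound hv.1.aestronglyMeasurable K (ae_of_all _ hK)).locallyIntegrable le_top)

theorem intervalMean_eq_intervalIntegral {f : ℝ → ℝ} {a b : ℝ} (hab : a < b) :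
    intervalMean f a b = (∫ x in a..b, f x) / (b - a) := by
  rw [intervalMean_eq hab, intervalIntegral.integral_of_le hab.le, integral_Ioc_eq_integral_Ioo]

theorem IsCascade.aInftyConst_le {q p₁ p₂ g P₁ P₂ P₃ ε : ℝ} {v : ℝ → ℝ}
    (hv : IsCascade q p₁ p₂ g P₁ P₂ P₃ ε v) : aInftyConst v ≤ ENNReal.ofReal (Real.exp q) := by
  refine iSup_le fun a => iSup_le fun b => iSup_le fun hab => ?_
  have hi : IntegrableOn (fun x => Real.log (v x)) (Icc a b) := by
    rw [integrableOn_Icc_iff_integrableOn_Ioc]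
    exact (hv.bounded.intervalIntegrable_log a b).1
  rw [aInftyOn, if_pos hi]
  refine ENNReal.ofReal_le_ofReal ?_
  have hba : 0 < b - a := sub_pos.2 hab
  rw [intervalMean_eq_intervalIntegral hab, intervalMean_eq_intervalIntegral hab, Real.exp_neg,
    ← div_eq_mul_inv, div_le_iff₀ (Real.exp_pos _), div_le_iff₀ hba, ← Real.exp_add, mul_comm]
  exact hv.reverseJensen a b hab

theorem IsCascade.le_rhOneConst {q p₁ p₂ g P₁ P₂ E ε : ℝ} {v : ℝ → ℝ} (hP₁ : 0 < P₁)
    (hv : IsCascade q p₁ p₂ g P₁ P₂ (P₁ * (E + Real.log P₁)) ε v) :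
    ENNReal.ofReal E ≤ rhOneConst v := by
  have h01 : (0 : ℝ) < 1 := one_pos
  have hm : intervalMean v 0 1 = P₁ := by
    rw [intervalMean_eq_intervalIntegral h01, hv.mean, sub_zero, div_one]
  obtain ⟨K, hK⟩ := hv.bounded.exists_abs_mul_log_le
  have hvl : IntervalIntegrable (fun x => v x * Real.log (v x)) volume 0 1 :=
    intervalIntegrable_of_measurable_of_abs_le (hv.bounded.1.mul hv.bounded.1.log) hK 0 1
  have hvi := hv.bounded.intervalIntegrable 0 1
  have heq : rhOneIntegrand v 0 1 =
      fun x => P₁⁻¹ * (v x * Real.log (v x)) - Real.log P₁ / P₁ * v x := by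
    funext x
    rw [rhOneIntegrand, hm, Real.log_div (hv.bounded.pos x).ne' hP₁.ne']
    field_simp
  have hi : IntegrableOn (rhOneIntegrand v 0 1) (Icc 0 1) := by
    rw [integrableOn_Icc_iff_integrableOn_Ioc, heq]
    exact ((hvl.const_mul _).sub (hvi.const_mul _)).1
  have hle : rhOneOn v 0 1 ≤ rhOneConst v :=
    le_iSup_of_le 0 (le_iSup_of_le 1 (le_iSup_of_le h01 le_rfl))
  refine le_of_eq_of_le ?_ hle
  rw [rhOneOn, if_pos hi, intervalMean_eq_intervalIntegral h01, heq,
    intervalIntegral.integral_sub (hvl.const_mul _) (hvi.const_mul _),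
    intervalIntegral.integral_const_mul, intervalIntegral.integral_const_mul, hv.mean,
    hv.mean_mul_log]
  congr 1
  field_simp
  ring

/-- The parameters are chosen in the order γ, θ, q, n. As θ → 0 one has M → 1, the entropy limit
tends to log γ + (1 − γ)/γ and exp Q to exp(γ − 1)/γ. Multiplied by γ, the required inequality
becomes C exp(γ − 1) < γ log γ + 1 − γ, which at γ = 0 is C < e. -/
theorem exists_parameters {C : ℝ} (hC : C < Real.exp 1) :
    ∃ γ θ M q : ℝ, ∃ n : ℕ, 0 < γ ∧ γ < 1 ∧ θ ∈ Ioo (0 : ℝ) 1 ∧ M = 1 - θ + θ * γ ∧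
      γ - 1 - Real.log γ - Real.log M < q ∧
      C * Real.exp q < (Real.log γ - M * Real.log M / (θ * γ)) * (1 - ((1 - θ) / M) ^ n) := by
  have hIoo : ∀ᶠ z : ℝ in nhdsWithin 0 (Ioi 0), z ∈ Ioo (0 : ℝ) 1 := Ioo_mem_nhdsGT one_pos
  obtain ⟨γ, ⟨hγ0, hγ1⟩, hγ⟩ : ∃ γ ∈ Ioo (0 : ℝ) 1,
      0 < γ * Real.log γ + (1 - γ) - C * Real.exp (γ - 1) := by
    have hcont : Continuous fun γ : ℝ => γ * Real.log γ + (1 - γ) - C * Real.exp (γ - 1) :=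
      (Real.continuous_mul_log.add (by fun_prop)).sub (by fun_prop)
    have h0 : (0 : ℝ) < 0 * Real.log 0 + (1 - 0) - C * Real.exp (0 - 1) := by
      have : C * Real.exp (-1) < 1 := by
        rw [Real.exp_neg, ← div_eq_mul_inv, div_lt_one (Real.exp_pos 1)]
        exact hC
      simpa using this
    have hev := (hcont.continuousAt.continuousWithinAt (s := Ioi 0)).eventually (lt_mem_nhds h0)
    obtain ⟨γ, h1, h2⟩ := (hIoo.and hev).exists
    exact ⟨γ, h1, h2⟩
  obtain ⟨θ, ⟨hθ0, hθ1⟩, hθ⟩ : ∃ θ ∈ Ioo (0 : ℝ) 1, 0 < γ * Real.log γ +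
      (1 - θ + θ * γ) * (1 - γ) - C * Real.exp (γ - 1) / (1 - θ + θ * γ) := by
    have hcont : ContinuousAt (fun θ : ℝ => γ * Real.log γ +
        (1 - θ + θ * γ) * (1 - γ) - C * Real.exp (γ - 1) / (1 - θ + θ * γ)) 0 := by
      refine ContinuousAt.sub (by fun_prop) (ContinuousAt.div (by fun_prop) (by fun_prop) (by simp))
    have hev := (hcont.continuousWithinAt (s := Ioi 0)).eventually
      (lt_mem_nhds (a := 0) (by simpa using hγ))
    obtain ⟨θ, h1, h2⟩ := (hIoo.and hev).exists
    exact ⟨θ, h1, h2⟩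
  obtain ⟨M, hM⟩ : ∃ M, M = 1 - θ + θ * γ := ⟨_, rfl⟩
  rw [← hM] at hθ
  have hM0 : 0 < M := by rw [hM]; nlinarith
  have hlM : Real.log M ≤ M - 1 := Real.log_le_sub_one_of_pos hM0
  set Q := γ - 1 - Real.log γ - Real.log M with hQ
  set E := Real.log γ - M * Real.log M / (θ * γ) with hE
  have hexp : Real.exp Q = Real.exp (γ - 1) / (γ * M) := by
    rw [hQ, Real.exp_sub, Real.exp_sub, Real.exp_log hγ0, Real.exp_log hM0, div_div]
  have hEQ : C * Real.exp Q < E := by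
    have h1 : Real.log γ + M * (1 - γ) / γ ≤ E := by
      -- Uses −log M ≥ 1 − M = θ(1 − γ), which removes θ from the denominator.
      have : M * (1 - γ) / γ ≤ -(M * Real.log M / (θ * γ)) := by
        rw [← neg_div, div_le_div_iff₀ hγ0 (by positivity)]
        have h2 : θ * (1 - γ) ≤ -Real.log M := by rw [hM] at hlM ⊢; linarith
        have h3 := mul_le_mul_of_nonneg_left h2 (mul_pos hM0 hγ0).le
        linarith
      rw [hE]
      linarith
    refine lt_of_lt_of_le ?_ h1
    rw [hexp]
    have h4 : Real.log γ + M * (1 - γ) / γ - C * (Real.exp (γ - 1) / (γ * M)) =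
        (γ * Real.log γ + M * (1 - γ) - C * Real.exp (γ - 1) / M) / γ := by
      field_simp
    have := div_pos hθ hγ0
    rw [← h4] at this
    linarith
  obtain ⟨q, hqQ, hqE⟩ : ∃ q, Q < q ∧ C * Real.exp q < E := by
    have hcont : Continuous fun q => C * Real.exp q := by fun_prop
    have hev := (hcont.continuousAt.continuousWithinAt (s := Ioi Q)).eventually (gt_mem_nhds hEQ)
    have hQI : ∀ᶠ q in nhdsWithin Q (Ioi Q), q ∈ Ioi Q := self_mem_nhdsWithin
    obtain ⟨q, h1, h2⟩ := (hQI.and hev).exists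
    exact ⟨q, h1, h2⟩
  have hρ : Filter.Tendsto (fun n : ℕ => E * (1 - ((1 - θ) / M) ^ n)) Filter.atTop (nhds E) := by
    have hlt : (1 - θ) / M < 1 := by
      rw [div_lt_one hM0, hM]
      linarith [mul_pos hθ0 hγ0]
    have := ((tendsto_pow_atTop_nhds_zero_of_lt_one
      (div_nonneg (by linarith) hM0.le) hlt).const_sub 1).const_mul E
    simpa using this
  obtain ⟨n, hn⟩ := (hρ.eventually (lt_mem_nhds hqE)).exists
  exact ⟨γ, θ, M, q, n, hγ0, hγ1, ⟨hθ0, hθ1⟩, hM, hqQ, hn⟩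

theorem exists_memAInfty_lt_rhOneConst {C : ℝ} (hC : C < Real.exp 1) :
    ∃ w : ℝ → ℝ, MemAInfty w ∧ ENNReal.ofReal C * aInftyConst w < rhOneConst w := by
  -- Replacing C by max C 1 makes the product with exp q positive, so that strict inequality
  -- survives `ENNReal.ofReal`.
  obtain ⟨γ, θ, M, q, n, hγ0, hγ1, hθ, hM, hq, hlt⟩ := exists_parameters (C := max C 1)
    (max_lt hC (by simp))
  obtain ⟨y, Dy, g, x, D, s, -, -, hx, -, -, -, -, -, hex⟩ := exists_isCascade hγ0 hγ1 hθ hM hq n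
  obtain ⟨v, hv⟩ := hex 1 one_pos
  refine ⟨v, ⟨hv.bounded.isWeight, hv.aInftyConst_le.trans_lt ENNReal.ofReal_lt_top⟩, ?_⟩
  have hpos : 0 < max C 1 * Real.exp q := mul_pos (lt_max_of_lt_right one_pos) (Real.exp_pos q)
  calc ENNReal.ofReal C * aInftyConst v
      ≤ ENNReal.ofReal (max C 1) * ENNReal.ofReal (Real.exp q) :=
        mul_le_mul' (ENNReal.ofReal_le_ofReal (le_max_left _ _)) hv.aInftyConst_le
    _ = ENNReal.ofReal (max C 1 * Real.exp q) :=
        (ENNReal.ofReal_mul (lt_max_of_lt_right one_pos).le).symm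
    _ < ENNReal.ofReal _ := (ENNReal.ofReal_lt_ofReal_iff (hpos.trans hlt)).2 hlt
    _ ≤ rhOneConst v := hv.le_rhOneConst hx

theorem theorem1p1 :
    (∀ w : ℝ → ℝ, IsWeight w → (MemAInfty w ↔ MemRHOne w)) ∧
    (∀ w : ℝ → ℝ, IsWeight w →
      rhOneConst w ≤ ENNReal.ofReal (Real.exp 1) * aInftyConst w) ∧
    (∀ C : ℝ, C < Real.exp 1 →
      ∃ w : ℝ → ℝ, MemAInfty w ∧ ENNReal.ofReal C * aInftyConst w < rhOneConst w) :=
  ⟨fun _ hw => memAInfty_iff_memRHOne hw, fun _ hw => rhOneConst_le hw,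
    fun _ hC => exists_memAInfty_lt_rhOneConst hC⟩
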